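/- Let $d>0$ and consider, in $1+1$ dimensions with metric $-dt^2+dx^2$, either full Minkowski space ($\eta=0$) or the half-space $x>0$ with Dirichlet ($\eta=-1$) or Neumann ($\eta=+1$) boundary condition at $x=0$. For $\epsilon>0$ put $\sigma^\mp_\epsilon(\mathsf x,\mathsf x')=\sqrt{(x\mp x')^2-(t-t'-i\epsilon)^2}$ (principal branch). The vacuum Wightman function of the field of mass $m>0$ is the limit $\epsilon\to0^+$ of $$W_{m,\epsilon}(\mathsf x,\mathsf x')=\frac1{2\pi}K_0\bigl(m\,\sigma^-_\epsilon\bigr)+\frac{\eta}{2\pi}K_0\bigl(m\,\sigma^+_\epsilon\bigr),$$ and that of the massless field, with an arbitrary infrared constant $\mu>0$, is the limit of $$W_{0,\mu,\epsilon}(\mathsf x,\mathsf x')=-\frac1{2\pi}\ln\bigl(\mu\,\sigma^-_\epsilon\bigr)-\frac{\eta}{2\pi}\ln\bigl(\mu\,\sigma^+_\epsilon\bigr).$$ A static detector with worldline $\mathsf x(\tau)=(\tau,d)$ and energy gap $E\in\mathbb R$ is coupled to the proper-time derivative of the field. With $\mathcal A_\epsilon(\tau',\tau'')=\partial_{\tau'}\partial_{\tau''}W_\epsilon(\mathsf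 x(\tau'),\mathsf x(\tau''))$, its response with switching function $\chi$ is $$\mathcal F_\epsilon[\chi](E)=\int d\tau'\int d\tau''\,\chi(\tau')\chi(\tau'')\,e^{-iE(\tau'-\tau'')}\mathcal A_\epsilon(\tau',\tau'').$$ Let $h_1,h_2$ be smooth non-negative functions on $\mathbb R$ that vanish for $x<0$ and equal $1$ for $x>1$, and let $\chi_{\delta,\tau_0,\tau}(u)=h_1\bigl(\frac{u-\tau_0+\delta}{\delta}\bigr)h_2\bigl(\frac{-u+\tau+\delta}{\delta}\bigr)$ for $\delta>0$, $\tau_0<\tau$. The (sharp-switched, stationary) transition rate at time $\tau$, with switch-on in the asymptotic past, is $$\dot{\mathcal F}(E)=\lim_{\epsilon\to0^+}\ \lim_{\tau_0\to-\infty}\ \lim_{\delta\to0^+}\ \frac{d}{d\tau}\mathcal F_\epsilon[\chi_{\delta,\tau_0,\tau}](E).$$ The stationary formula for it is $\lim_{\epsilon\to0^+}\lim_{R\to\infty}\int_{-R}^{R}ds\,e^{-iEs}\mathcal A_\epsilon(s,0)$. With $\Theta$ the Heaviside function, for all such $h_1,h_2$ and all $\tau\in\mathbb R$ the following hold. 1.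 For every $m>0$ and every real $E\neq-m$, all these limits and derivatives exist for the field of mass $m$, and both the transition rate and the stationary formula are equal to $$\dot{\mathcal F}_m(E)=\frac{E^2}{\sqrt{E^2-m^2}}\Bigl(1+\eta\cos\bigl(2d\sqrt{E^2-m^2}\bigr)\Bigr)\Theta(-E-m)$$ (understood as $0$ where $E>-m$). 2. For every real $E$ and every $\mu>0$, the same holds for the massless field, with the value $$\dot{\mathcal F}_0(E)=-E\bigl(1+\eta\cos(2dE)\bigr)\Theta(-E),$$ which is independent of $\mu$. 3. For every real $E$, $\lim_{m\to0^+}\dot{\mathcal F}_m(E)=\dot{\mathcal F}_0(E)$: the transition rate is continuous at $m=0$, although the Wightman functions themselves are not. -/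

import Mathlib

open Set Filter Topology MeasureTheory
open scoped ContDiff

noncomputable section

namespace DerivDetector

/-- A point of `1+1` Minkowski space in standard coordinates `(t, x)`, metric `-dt² + dx²`. -/
abbrev Point : Type := ℝ × ℝ

/-- The modified Bessel function `K₀(z)`, by its integral representation
`K₀(z) = ∫_0^∞ e^{-z cosh u} du`, valid for `Re z > 0`.  It is only evaluated there. -/
def besselK0 (z : ℂ) : ℂ :=
  ∫ u in Ioi (0 : ℝ), Complex.exp (-z * (Real.cosh u : ℂ))

/-- The regularised invariant distance `√((x - x')² - (t - t' - iε)²)` (principal branch).  For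
`ε > 0` the radicand is never in `(-∞, 0]`, so the root has positive real part. -/
def regDist (ε : ℝ) (p q : Point) : ℂ :=
  (((p.2 - q.2 : ℝ) : ℂ) ^ 2 - (((p.1 - q.1 : ℝ) : ℂ) - Complex.I * (ε : ℂ)) ^ 2) ^ (1 / 2 : ℂ)

/-- The mirror image of a point with respect to the boundary `x = 0`. -/
def mirror (p : Point) : Point := (p.1, -p.2)

/-- The three situations: full Minkowski space, and the half-space `x > 0` with Dirichlet or
Neumann condition at `x = 0`. -/
inductive Setting where
  | full : Setting
  | dirichlet : Setting
  | neumann : Setting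

/-- The sign `η` of the image term: `0` for full Minkowski space, `-1` for Dirichlet and `+1` for
Neumann boundary conditions. -/
def Setting.eta : Setting → ℝ
  | Setting.full => 0
  | Setting.dirichlet => -1
  | Setting.neumann => 1

/-- The family `W_ε` (`ε > 0`) whose limit as `ε → 0⁺` is the vacuum Wightman function
`⟨Φ(p) Φ(q)⟩` of the field of mass `m > 0`; the image term has `(x + x')²` in place of
`(x - x')²`. -/
def massiveWightman (S : Setting) (m ε : ℝ) (p q : Point) : ℂ :=
  1 / (2 * (Real.pi : ℂ)) * besselK0 ((m : ℂ) * regDist ε p q)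
    + (S.eta : ℂ) / (2 * (Real.pi : ℂ)) * besselK0 ((m : ℂ) * regDist ε p (mirror q))

/-- The same for the massless field; `μ > 0` is the arbitrary infrared constant. -/
def masslessWightman (S : Setting) (μ ε : ℝ) (p q : Point) : ℂ :=
  -(1 / (2 * (Real.pi : ℂ))) * Complex.log ((μ : ℂ) * regDist ε p q)
    - (S.eta : ℂ) / (2 * (Real.pi : ℂ)) * Complex.log ((μ : ℂ) * regDist ε p (mirror q))

/-- The static worldline at position `x = d`, parametrised by proper time. -/
def staticWorldline (d τ : ℝ) : Point := (τ, d)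

/-- The two-point function seen by a derivative-coupling detector on the worldline `γ`:
`A(τ', τ'') = ∂_{τ'} ∂_{τ''} W(γ(τ'), γ(τ''))`. -/
def derivCorrelation (W : Point → Point → ℂ) (γ : ℝ → Point) (a b : ℝ) : ℂ :=
  deriv (fun a' : ℝ => deriv (fun b' : ℝ => W (γ a') (γ b')) b) a

/-- The response function of a detector with energy gap `E` and switching function `χ`:
`∫ dτ' ∫ dτ'' χ(τ') χ(τ'') e^{-iE(τ' - τ'')} A(τ', τ'')`. -/
def response (A : ℝ → ℝ → ℂ) (E : ℝ) (χ : ℝ → ℝ) : ℂ :=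
  ∫ a : ℝ, ∫ b : ℝ,
    (χ a : ℂ) * (χ b : ℂ) * Complex.exp (-Complex.I * (E : ℂ) * ((a - b : ℝ) : ℂ)) * A a b

/-- A smooth, non-negative switching profile: `0` for `x < 0` and `1` for `x > 1`. -/
structure IsSwitchProfile (h : ℝ → ℝ) : Prop where
  smooth : ContDiff ℝ ∞ h
  nonneg : ∀ x, 0 ≤ h x
  eq_zero : ∀ x, x < 0 → h x = 0
  eq_one : ∀ x, 1 < x → h x = 1

/-- The switching function that is switched on during `[τ₀ - δ, τ₀]` according to `h₁`, equals `1`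
on `[τ₀, τ]`, and is switched off during `[τ, τ + δ]` according to `h₂`. -/
def switching (h₁ h₂ : ℝ → ℝ) (δ τ₀ τ : ℝ) (u : ℝ) : ℝ :=
  h₁ ((u - τ₀ + δ) / δ) * h₂ ((-u + τ + δ) / δ)

/-- `r` is the sharp-switching transition rate at proper time `τ` of a detector that is switched on
at `τ₀`: the derivative of the response with respect to `τ`, in the limit `δ → 0⁺`. -/
def HasSharpRate (A : ℝ → ℝ → ℂ) (h₁ h₂ : ℝ → ℝ) (E τ₀ τ : ℝ) (r : ℂ) : Prop :=
  ∃ D : ℝ → ℂ,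
    (∀ δ : ℝ, 0 < δ →
      HasDerivAt (fun t : ℝ => response A E (switching h₁ h₂ δ τ₀ t)) (D δ) τ) ∧
    Tendsto D (𝓝[>] 0) (𝓝 r)

/-- The sharp-switching transition rate with the switch-on in the asymptotic past, `τ₀ → -∞`. -/
def HasAsymptoticRate (A : ℝ → ℝ → ℂ) (h₁ h₂ : ℝ → ℝ) (E τ : ℝ) (r : ℂ) : Prop :=
  ∃ f : ℝ → ℂ, (∀ τ₀ : ℝ, τ₀ < τ → HasSharpRate A h₁ h₂ E τ₀ τ (f τ₀)) ∧
    Tendsto f atBot (𝓝 r)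

/-- `r` is the instantaneous transition rate at proper time `τ`, with gap `E`, of the
derivative-coupling detector on the worldline `γ`, sharply switched on in the asymptotic past and
coupled to a field whose Wightman function is the limit of the family `W ε` as `ε → 0⁺`. The
regulator is removed last. -/
def HasTransitionRate (W : ℝ → Point → Point → ℂ) (γ : ℝ → Point) (h₁ h₂ : ℝ → ℝ)
    (E τ r : ℝ) : Prop :=
  ∃ f : ℝ → ℂ,
    (∀ ε : ℝ, 0 < ε → HasAsymptoticRate (derivCorrelation (W ε) γ) h₁ h₂ E τ (f ε)) ∧
    Tendsto f (𝓝[>] 0) (𝓝 (r : ℂ))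

/-- `r` is the value of the stationary transition rate formula
`∫_{-∞}^∞ ds e^{-iEs} A(s - iε, 0)`, as an improper Riemann integral for each `ε > 0` followed by
the limit `ε → 0⁺`. -/
def HasStationaryRate (W : ℝ → Point → Point → ℂ) (γ : ℝ → Point) (E r : ℝ) : Prop :=
  ∃ f : ℝ → ℂ,
    (∀ ε : ℝ, 0 < ε →
      Tendsto (fun R : ℝ => ∫ s in (-R)..R,
        Complex.exp (-Complex.I * (E : ℂ) * (s : ℂ)) * derivCorrelation (W ε) γ s 0)
        atTop (𝓝 (f ε))) ∧
    Tendsto f (𝓝[>] 0) (𝓝 (r : ℂ))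

/-- The Heaviside step function. Its value at `0` plays no role. -/
def heaviside (x : ℝ) : ℝ := if 0 < x then 1 else 0

/-- `E² / √(E² - m²) · (1 + η cos(2d √(E² - m²))) · Θ(-E - m)`. -/
def massiveRate (S : Setting) (d m E : ℝ) : ℝ :=
  E ^ 2 / √(E ^ 2 - m ^ 2) * (1 + S.eta * Real.cos (2 * d * √(E ^ 2 - m ^ 2)))
    * heaviside (-E - m)

/-- `-E · (1 + η cos(2dE)) · Θ(-E)`. -/
def masslessRate (S : Setting) (d E : ℝ) : ℝ :=
  -E * (1 + S.eta * Real.cos (2 * d * E)) * heaviside (-E)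

end DerivDetector

end

/-! Along a static worldline the regularised Wightman function depends only on `ζ = ε + i(τ' -
τ'')`, and it is analytic for `Re ζ > 0`. The whole result rests on one spectral identity, recorded
by `HasSpectralRate`: `A_ε(s) = (1/2π) ∫ ρ(-ν) e^{-(ε+is)ν} dν`, where `ρ` is the claimed rate
itself.

In the massive case, `ζ² + Δx²` is factored into the light-cone parameters `ζ ∓ iΔx`. The integral
of `exp(-(p e^u + q e^{-u})/2)` equals `2 K₀(√(pq))`: for real parameters by a translation in `u`,
then in general by analytic continuation (`lightConeIntegral_eq`). This gives the rapidity integral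
`K₀ = ∫_0^∞ cos(m Δx sinh u) e^{-ζ m cosh u} du`. Two derivatives bring down `(m cosh u)²`, and the
substitution `ν = m cosh u` turns the weight into `ρ(-ν)`; its Jacobian produces the factor `1/√(ν²
- m²)`. In the massless case the second derivatives are inverse squares, the Laplace transforms of
`ν` and its shifts.

For a stationary correlation, the sharp-switched rate is exactly the integral of `e^{-iEs} A_ε(s)`
over `[-(τ-τ₀), τ-τ₀]` (`hasSharpRate_of_stationary`). Hence switch-on in the asymptotic past and
the stationary formula lead to the same symmetric improper integral. Pointwise Fourier inversion of
`ρ(-ν) e^{-εν}` at `ν = -E` evaluates it as `ρ(E) e^{εE}`, which tends to `ρ(E)` as `ε → 0⁺`.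
Inversion needs only a Lipschitz bound at the one point; this holds away from the threshold `E =
-m`, and everywhere in the massless case. Continuity at `m = 0` is then read off the explicit
formulas. -/

noncomputable section

namespace DerivDetector

/-! ### Differentiation of Laplace-type integrals. -/

section Laplace

variable {α : Type*} [MeasurableSpace α] {μ : Measure α} {X : α → ℝ} {w : α → ℂ}

/-- The weight `w` is integrable against `e^{-cX}` for all `c > 0`. -/
structure LaplaceIntegrable (μ : Measure α) (X : α → ℝ) (w : α → ℂ) : Prop where
  nonneg : ∀ x, 0 ≤ X x
  measurable : Measurable X
  aestronglyMeasurable : AEStronglyMeasurable w μ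
  integrable : ∀ c : ℝ, 0 < c → Integrable (fun x => ‖w x‖ * Real.exp (-(c * X x))) μ

theorem norm_mul_cexp_neg_mul (a z : ℂ) (r : ℝ) :
    ‖a * Complex.exp (-(z * r))‖ = ‖a‖ * Real.exp (-(z.re * r)) := by
  rw [norm_mul, Complex.norm_exp]
  simp

theorem LaplaceIntegrable.aestronglyMeasurable_mul_exp (h : LaplaceIntegrable μ X w) (z : ℂ) :
    AEStronglyMeasurable (fun x => w x * Complex.exp (-(z * X x))) μ := by
  have := h.measurable
  exact h.aestronglyMeasurable.mul (by fun_prop)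

theorem LaplaceIntegrable.integrable_mul_exp (h : LaplaceIntegrable μ X w) {z : ℂ}
    (hz : 0 < z.re) : Integrable (fun x => w x * Complex.exp (-(z * X x))) μ := by
  refine (h.integrable z.re hz).mono' (h.aestronglyMeasurable_mul_exp z) ?_
  exact ae_of_all _ fun x => (norm_mul_cexp_neg_mul _ _ _).le

theorem LaplaceIntegrable.of_norm_le (h : LaplaceIntegrable μ X w) {w' : α → ℂ}
    (hw' : AEStronglyMeasurable w' μ) {C : ℝ} (hC : ∀ x, ‖w' x‖ ≤ C * ‖w x‖) :
    LaplaceIntegrable μ X w' := by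
  have hm := h.measurable
  refine ⟨h.nonneg, hm, hw', fun c hc => ((h.integrable c hc).const_mul C).mono' ?_ ?_⟩
  · exact hw'.norm.mul (by fun_prop)
  · refine ae_of_all _ fun x => ?_
    rw [Real.norm_of_nonneg (by positivity), ← mul_assoc]
    exact mul_le_mul_of_nonneg_right (hC x) (Real.exp_pos _).le

theorem mul_exp_neg_mul_le {c : ℝ} (hc : 0 < c) (r : ℝ) :
    r * Real.exp (-(c * r)) ≤ 2 / c * Real.exp (-(c / 2 * r)) := by
  have h1 : Real.exp (-(c * r)) = Real.exp (-(c / 2 * r)) * Real.exp (-(c / 2 * r)) := by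
    rw [← Real.exp_add]; ring_nf
  have h2 : c / 2 * r * Real.exp (-(c / 2 * r)) ≤ 1 := by
    rw [Real.exp_neg, ← div_eq_mul_inv, div_le_one (Real.exp_pos _)]
    linarith [Real.add_one_le_exp (c / 2 * r)]
  have h3 : r * Real.exp (-(c / 2 * r)) ≤ 2 / c := by
    rw [le_div_iff₀ hc]; nlinarith
  rw [h1, ← mul_assoc]
  exact mul_le_mul_of_nonneg_right h3 (Real.exp_pos _).le

/-- Half of the exponential decay absorbs the extra factor `X`. The class of weights is thus closed
under differentiation in `z`, so `hasDerivAt` can be iterated. -/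
theorem LaplaceIntegrable.neg_mul (h : LaplaceIntegrable μ X w) :
    LaplaceIntegrable μ X (fun x => -(X x : ℂ) * w x) := by
  have hm := h.measurable
  have hs : AEStronglyMeasurable (fun x => -(X x : ℂ) * w x) μ :=
    AEStronglyMeasurable.mul (by fun_prop) h.aestronglyMeasurable
  refine ⟨h.nonneg, hm, hs, fun c hc =>
    ((h.integrable (c / 2) (half_pos hc)).const_mul (2 / c)).mono' ?_ ?_⟩
  · exact hs.norm.mul (by fun_prop)
  · refine ae_of_all _ fun x => ?_
    have := mul_le_mul_of_nonneg_left (mul_exp_neg_mul_le hc (X x)) (norm_nonneg (w x))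
    rw [Real.norm_of_nonneg (by positivity), norm_mul, norm_neg, Complex.norm_real,
      Real.norm_of_nonneg (h.nonneg x)]
    linarith

theorem LaplaceIntegrable.hasDerivAt (h : LaplaceIntegrable μ X w) {z : ℂ} (hz : 0 < z.re) :
    HasDerivAt (fun z : ℂ => ∫ x, w x * Complex.exp (-(z * X x)) ∂μ)
      (∫ x, -(X x : ℂ) * w x * Complex.exp (-(z * X x)) ∂μ) z := by
  -- On this half-plane the decay rate is at least `z.re / 2`, which gives a uniform dominating
  -- function.
  have hs : {y : ℂ | z.re / 2 < y.re} ∈ 𝓝 z :=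
    (isOpen_lt continuous_const Complex.continuous_re).mem_nhds (by simp [hz])
  refine (hasDerivAt_integral_of_dominated_loc_of_deriv_le hs
    (F := fun z x => w x * Complex.exp (-(z * X x)))
    (F' := fun z x => -(X x : ℂ) * w x * Complex.exp (-(z * X x)))
    (bound := fun x => ‖-(X x : ℂ) * w x‖ * Real.exp (-(z.re / 2 * X x)))
    (Eventually.of_forall fun y => h.aestronglyMeasurable_mul_exp y)
    (h.integrable_mul_exp hz) (h.neg_mul.aestronglyMeasurable_mul_exp z) ?_
    (h.neg_mul.integrable _ (half_pos hz)) ?_).2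
  · refine ae_of_all _ fun x y hy => ?_
    rw [norm_mul_cexp_neg_mul]
    have : z.re / 2 * X x ≤ y.re * X x := mul_le_mul_of_nonneg_right hy.le (h.nonneg x)
    gcongr
  · refine ae_of_all _ fun x y _ => ?_
    have h1 : HasDerivAt (fun y : ℂ => -(y * X x)) (-(X x : ℂ)) y := by
      simpa using ((hasDerivAt_id y).mul_const (X x : ℂ)).fun_neg
    convert! (h1.cexp.const_mul (w x)) using 1
    ring

end Laplace

/-! ### `K₀` as a light-cone integral. -/

theorem sq_div_four_le_cosh (u : ℝ) : u ^ 2 / 4 ≤ Real.cosh u := by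
  have h := Real.quadratic_le_exp_of_nonneg (abs_nonneg u)
  have h2 := Real.cosh_abs u
  rw [Real.cosh_eq] at h2
  have h3 := Real.exp_pos (-|u|)
  have h4 := sq_abs u
  nlinarith [abs_nonneg u]

theorem integrable_exp_neg_mul_cosh {c : ℝ} (hc : 0 < c) :
    Integrable (fun u : ℝ => Real.exp (-(c * Real.cosh u))) := by
  refine (integrable_exp_neg_mul_sq (b := c / 4) (by positivity)).mono'
    (by fun_prop) (ae_of_all _ fun u => ?_)
  rw [Real.norm_of_nonneg (Real.exp_pos _).le, Real.exp_le_exp]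
  nlinarith [sq_div_four_le_cosh u]

theorem laplaceIntegrable_mul_cosh {m : ℝ} (hm : 0 < m) (s : Set ℝ) {w : ℝ → ℂ}
    (hw : Continuous w) (h1 : ∀ u, ‖w u‖ ≤ 1) :
    LaplaceIntegrable (volume.restrict s) (fun u => m * Real.cosh u) w := by
  refine LaplaceIntegrable.of_norm_le (w := fun _ => 1) (C := 1) ⟨fun u => ?_, by fun_prop,
    aestronglyMeasurable_const, fun c hc => ?_⟩ hw.aestronglyMeasurable (by simpa using h1)
  · have := Real.cosh_pos u
    positivity
  · simpa [IntegrableOn, mul_assoc] using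
      (integrable_exp_neg_mul_cosh (mul_pos hc hm)).integrableOn (s := s)

theorem differentiableOn_besselK0 : DifferentiableOn ℂ besselK0 {z | 0 < z.re} := by
  intro z hz
  have h := (laplaceIntegrable_mul_cosh one_pos (Ioi 0) (w := fun _ => 1) continuous_const
    (by simp)).hasDerivAt hz
  simp only [one_mul, ← neg_mul] at h
  exact h.differentiableAt.differentiableWithinAt

theorem integral_eq_integral_Ioi_add_comp_neg {f : ℝ → ℂ} (hf : Integrable f) :
    ∫ u, f u = ∫ u in Ioi (0 : ℝ), (f u + f (-u)) := by
  rw [integral_add hf.integrableOn hf.comp_neg.integrableOn, integral_comp_neg_Ioi, neg_zero,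
    add_comm, intervalIntegral.integral_Iic_add_Ioi hf.integrableOn hf.integrableOn]

theorem norm_exp_lightCone (p q : ℂ) (u : ℝ) :
    ‖Complex.exp (-((p * Real.exp u + q * Real.exp (-u)) / 2))‖ =
      Real.exp (-((p.re * Real.exp u + q.re * Real.exp (-u)) / 2)) := by
  rw [Complex.norm_exp]
  congr 1
  rw [Complex.neg_re, Complex.div_ofNat_re, Complex.add_re, Complex.re_mul_ofReal,
    Complex.re_mul_ofReal]

theorem integrable_exp_lightCone {p q : ℂ} (hp : 0 < p.re) (hq : 0 < q.re) :
    Integrable (fun u : ℝ => Complex.exp (-((p * Real.exp u + q * Real.exp (-u)) / 2))) := by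
  refine (integrable_exp_neg_mul_cosh (lt_min hp hq)).mono' (by fun_prop)
    (ae_of_all _ fun u => ?_)
  rw [norm_exp_lightCone, Real.exp_le_exp, Real.cosh_eq]
  nlinarith [min_le_left p.re q.re, min_le_right p.re q.re, Real.exp_pos u, Real.exp_pos (-u)]

/-- The integral `∫ exp (-(p e^u + q e^{-u}) / 2) du`, in light-cone parameters. -/
def lightConeIntegral (p q : ℂ) : ℂ :=
  ∫ u : ℝ, Complex.exp (-((p * Real.exp u + q * Real.exp (-u)) / 2))

theorem lightConeIntegral_comm (p q : ℂ) : lightConeIntegral p q = lightConeIntegral q p := by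
  unfold lightConeIntegral
  rw [← integral_neg_eq_self]
  simp only [neg_neg, add_comm]

/-- As a function of `p` this is a Laplace integral in `e^u / 2`; the factor containing `q` serves
as the weight. -/
theorem differentiableOn_lightConeIntegral {q : ℂ} (hq : 0 < q.re) :
    DifferentiableOn ℂ (fun p => lightConeIntegral p q) {p | 0 < p.re} := by
  have h : LaplaceIntegrable volume (fun u : ℝ => Real.exp u / 2)
      (fun u => Complex.exp (-(q * Real.exp (-u) / 2))) := by
    refine ⟨fun u => by positivity, by fun_prop, by fun_prop, fun c hc => ?_⟩
    have := (integrable_exp_lightCone (p := c) (by simpa using hc) hq).norm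
    refine this.congr (ae_of_all _ fun u => ?_)
    dsimp only
    rw [norm_exp_lightCone, Complex.norm_exp, ← Real.exp_add, Complex.ofReal_re,
      Complex.neg_re, Complex.div_ofNat_re, Complex.re_mul_ofReal]
    ring_nf
  intro p hp
  refine (DifferentiableAt.congr_of_eventuallyEq (h.hasDerivAt hp).differentiableAt ?_
    ).differentiableWithinAt
  refine Eventually.of_forall fun y => integral_congr_ae (ae_of_all _ fun u => ?_)
  dsimp only
  rw [← Complex.exp_add]
  push_cast
  ring_nf

/-- Each argument lies in `(-π/2, π/2)`. So the product avoids the branch cut, principal logarithms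
add, and the principal root of the product has positive real part. -/
theorem arg_add_arg_mem_Ioo {p q : ℂ} (hp : 0 < p.re) (hq : 0 < q.re) :
    p.arg + q.arg ∈ Ioo (-Real.pi) Real.pi := by
  have h1 := abs_lt.1 (Complex.abs_arg_lt_pi_div_two_iff.2 (Or.inl hp))
  have h2 := abs_lt.1 (Complex.abs_arg_lt_pi_div_two_iff.2 (Or.inl hq))
  constructor <;> linarith [h1.1, h1.2, h2.1, h2.2]

theorem ne_zero_of_re_pos {p : ℂ} (hp : 0 < p.re) : p ≠ 0 := by
  rintro rfl; simp at hp

theorem log_mul_of_re_pos {p q : ℂ} (hp : 0 < p.re) (hq : 0 < q.re) :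
    Complex.log (p * q) = Complex.log p + Complex.log q :=
  Complex.log_mul (ne_zero_of_re_pos hp) (ne_zero_of_re_pos hq)
    (Ioo_subset_Ioc_self (arg_add_arg_mem_Ioo hp hq))

theorem mul_mem_slitPlane {p q : ℂ} (hp : 0 < p.re) (hq : 0 < q.re) :
    p * q ∈ Complex.slitPlane := by
  have h := arg_add_arg_mem_Ioo hp hq
  rw [Complex.mem_slitPlane_iff_arg, Complex.arg_mul (ne_zero_of_re_pos hp)
    (ne_zero_of_re_pos hq) (Ioo_subset_Ioc_self h)]
  exact ⟨h.2.ne, mul_ne_zero (ne_zero_of_re_pos hp) (ne_zero_of_re_pos hq)⟩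

theorem re_sqrt_pos {x : ℂ} (hx : x ∈ Complex.slitPlane) : 0 < (x ^ (1 / 2 : ℂ)).re := by
  have h0 := Complex.slitPlane_ne_zero hx
  have h := (Complex.mem_slitPlane_iff_arg.1 hx).1
  rw [Complex.cpow_def_of_ne_zero h0, Complex.exp_re]
  refine mul_pos (Real.exp_pos _) (Real.cos_pos_of_mem_Ioo ?_)
  have : (Complex.log x * (1 / 2)).im = x.arg / 2 := by
    rw [show Complex.log x * (1 / 2) = Complex.log x / 2 by ring, Complex.div_ofNat_im,
      Complex.log_im]
  rw [this]
  have h1 := Complex.neg_pi_lt_arg x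
  have h2 := lt_of_le_of_ne (Complex.arg_le_pi x) h
  constructor <;> linarith

theorem differentiableOn_besselK0_sqrt_mul {q : ℂ} (hq : 0 < q.re) :
    DifferentiableOn ℂ (fun p => 2 * besselK0 ((p * q) ^ (1 / 2 : ℂ))) {p | 0 < p.re} := by
  have hmem : ∀ p : ℂ, 0 < p.re → p * q ∈ Complex.slitPlane :=
    fun p hp => mul_mem_slitPlane hp hq
  have h : DifferentiableOn ℂ (besselK0 ∘ fun p => (p * q) ^ (1 / 2 : ℂ)) {p | 0 < p.re} := by
    refine differentiableOn_besselK0.comp (fun p hp => ?_) (fun p hp => re_sqrt_pos (hmem p hp))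
    exact ((differentiableAt_id.mul_const q).cpow_const (hmem p hp)).differentiableWithinAt
  exact h.const_mul 2

/-- Identity theorem on the right half-plane. -/
theorem eq_of_eq_on_pos_real {f g : ℂ → ℂ} (hf : DifferentiableOn ℂ f {p | 0 < p.re})
    (hg : DifferentiableOn ℂ g {p | 0 < p.re}) (h : ∀ x : ℝ, 0 < x → f x = g x) {p : ℂ}
    (hp : 0 < p.re) : f p = g p := by
  have ho : IsOpen {p : ℂ | 0 < p.re} := isOpen_lt continuous_const Complex.continuous_re
  have hc : IsPreconnected {p : ℂ | 0 < p.re} :=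
    (convex_halfSpace_re_gt 0).isPreconnected
  refine AnalyticOnNhd.eqOn_of_preconnected_of_frequently_eq (hf.analyticOnNhd ho)
    (hg.analyticOnNhd ho) hc (z₀ := 1) (by simp) ?_ hp
  -- The two functions agree at real points accumulating at `1` from the right, which is enough for
  -- the identity theorem.
  have ht : Tendsto (fun x : ℝ => (x : ℂ)) (𝓝[>] 1) (𝓝[≠] 1) := by
    refine tendsto_nhdsWithin_iff.2 ⟨?_, ?_⟩
    · exact (Complex.continuous_ofReal.tendsto' 1 1 (by simp)).mono_left nhdsWithin_le_nhds
    · filter_upwards [self_mem_nhdsWithin] with x hx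
      simpa using (ne_of_gt (mem_Ioi.1 hx))
  refine ht.frequently (Eventually.frequently ?_)
  filter_upwards [self_mem_nhdsWithin] with x hx
  exact h x (zero_lt_one.trans hx)

/-- The translation by `β = log (σ / p)` balances both coefficients to `σ = √(pq)`. Folding `u` with
`-u` then leaves twice the defining integral of `K₀`. -/
theorem lightConeIntegral_ofReal {p q : ℝ} (hp : 0 < p) (hq : 0 < q) :
    lightConeIntegral p q = 2 * besselK0 (((p : ℂ) * q) ^ (1 / 2 : ℂ)) := by
  have hσ : ((p : ℂ) * q) ^ (1 / 2 : ℂ) = (√(p * q) : ℝ) := by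
    rw [Real.sqrt_eq_rpow, Complex.ofReal_cpow (mul_pos hp hq).le]
    push_cast
    rfl
  set σ := √(p * q) with hσd
  have hσ0 : 0 < σ := Real.sqrt_pos.2 (mul_pos hp hq)
  have hσ2 : σ * σ = p * q := Real.mul_self_sqrt (mul_pos hp hq).le
  set β := Real.log (σ / p)
  have hβ : Real.exp β = σ / p := Real.exp_log (by positivity)
  have key : lightConeIntegral p q = lightConeIntegral σ σ := by
    unfold lightConeIntegral
    rw [← integral_add_right_eq_self _ β]
    refine integral_congr_ae (ae_of_all _ fun u => ?_)
    dsimp only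
    have e1 : (p : ℂ) * (Real.exp (u + β) : ℝ) = σ * Real.exp u := by
      have hpc : (p : ℂ) ≠ 0 := by exact_mod_cast hp.ne'
      rw [Real.exp_add, hβ]
      push_cast
      field_simp
    have e2 : (q : ℂ) * (Real.exp (-(u + β)) : ℝ) = σ * Real.exp (-u) := by
      norm_cast
      rw [neg_add, Real.exp_add, Real.exp_neg β, hβ]
      field_simp
      nlinarith [Real.exp_pos (-u)]
    rw [e1, e2]
  rw [key, hσ, lightConeIntegral, integral_eq_integral_Ioi_add_comp_neg
    (integrable_exp_lightCone (by simpa using hσ0) (by simpa using hσ0)), besselK0,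
    ← integral_const_mul]
  refine integral_congr_ae (ae_of_all _ fun u => ?_)
  dsimp only
  rw [neg_neg, add_comm ((σ : ℂ) * (Real.exp (-u) : ℝ)), ← two_mul, Real.cosh_eq]
  push_cast
  ring_nf

/-- For complex parameters the balancing translation would leave the real line, so the identity is
continued analytically, one variable at a time: first in `p` with `q` real, then in `p` with `q`
complex, the real points being supplied by the symmetry of the integral. -/
theorem lightConeIntegral_eq {p q : ℂ} (hp : 0 < p.re) (hq : 0 < q.re) :
    lightConeIntegral p q = 2 * besselK0 ((p * q) ^ (1 / 2 : ℂ)) := by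
  have h1 : ∀ {p : ℂ} {q : ℝ}, 0 < p.re → 0 < q →
      lightConeIntegral p q = 2 * besselK0 ((p * q) ^ (1 / 2 : ℂ)) := fun {p q} hp hq =>
    eq_of_eq_on_pos_real
      (differentiableOn_lightConeIntegral (q := q) (by simpa using hq))
      (differentiableOn_besselK0_sqrt_mul (q := q) (by simpa using hq))
      (fun x hx => lightConeIntegral_ofReal hx hq) hp
  refine eq_of_eq_on_pos_real (differentiableOn_lightConeIntegral hq)
    (differentiableOn_besselK0_sqrt_mul hq) (fun x hx => ?_) hp
  rw [lightConeIntegral_comm, h1 hq hx, mul_comm q]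

/-! ### Pointwise Fourier inversion. -/

section Fourier

open scoped FourierTransform

theorem fourier_pi_gaussian :
    𝓕 (fun x : ℝ => Complex.exp (-Real.pi * x ^ 2)) =
      fun x : ℝ => Complex.exp (-Real.pi * x ^ 2) := by
  simpa using fourier_gaussian_pi (b := 1) (by simp)

theorem integrable_pi_gaussian :
    Integrable (fun x : ℝ => Complex.exp (-Real.pi * x ^ 2)) :=
  integrable_cexp_neg_mul_sq (b := Real.pi) (by simpa using Real.pi_pos)

theorem integral_pi_gaussian :
    ∫ x : ℝ, Complex.exp (-Real.pi * x ^ 2) = 1 := by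
  have h := integral_gaussian_complex (b := Real.pi) (by simpa using Real.pi_pos)
  rw [h, div_self (by exact_mod_cast Real.pi_ne_zero), Complex.one_cpow]

theorem norm_one_sub_pi_gaussian_le (x : ℝ) :
    ‖1 - Complex.exp (-Real.pi * x ^ 2)‖ ≤ Real.pi * x ^ 2 := by
  have h : (1 : ℂ) - Complex.exp (-Real.pi * x ^ 2) =
      ((1 - Real.exp (-(Real.pi * x ^ 2)) : ℝ) : ℂ) := by
    push_cast; ring_nf
  have hp : 0 ≤ Real.pi * x ^ 2 := by positivity
  rw [h, Complex.norm_real, Real.norm_of_nonneg]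
  · linarith [Real.add_one_le_exp (-(Real.pi * x ^ 2))]
  · have : Real.exp (-(Real.pi * x ^ 2)) ≤ 1 := Real.exp_le_one_iff.2 (by linarith)
    linarith

/-- Near `0` the quotient is bounded by `|C|`; outside a ball of radius `r` it is at most `‖f x‖ /
r`. -/
theorem integrable_div_of_le_mul_abs {f : ℝ → ℂ} (hf : Integrable f) {C : ℝ}
    (hC : ∀ᶠ x in 𝓝 (0 : ℝ), ‖f x‖ ≤ C * |x|) : Integrable (fun x : ℝ => f x / x) := by
  obtain ⟨r, hr, hrC⟩ := Metric.eventually_nhds_iff_ball.1 hC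
  have hb : Integrable (fun x => (Metric.ball (0 : ℝ) r).indicator (fun _ => |C|) x +
      r⁻¹ * ‖f x‖) := by
    refine Integrable.add ?_ (hf.norm.const_mul _)
    rw [integrable_indicator_iff measurableSet_ball]
    exact integrableOn_const measure_ball_lt_top.ne
  refine hb.mono' (hf.aestronglyMeasurable.mul ?_) (ae_of_all _ fun x => ?_)
  · exact (Complex.measurable_ofReal.inv).aestronglyMeasurable
  · rw [norm_div, Complex.norm_real, Real.norm_eq_abs]
    by_cases hx : x ∈ Metric.ball (0 : ℝ) r
    · rw [indicator_of_mem hx]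
      have h1 := hrC x hx
      have h2 : ‖f x‖ / |x| ≤ |C| := by
        refine div_le_of_le_mul₀ (abs_nonneg x) (abs_nonneg C) (h1.trans ?_)
        exact mul_le_mul_of_nonneg_right (le_abs_self C) (abs_nonneg x)
      have : 0 ≤ r⁻¹ * ‖f x‖ := by positivity
      linarith
    · rw [indicator_of_notMem hx, zero_add, div_eq_inv_mul]
      have : r ≤ |x| := by simpa using hx
      gcongr

/-- With `θ = f / x` integrable, `𝓕 f` is the derivative of `-(2πi)⁻¹ 𝓕 θ`. The integral is
therefore a difference of boundary values, which vanish at infinity by the Riemann–Lebesgue lemma.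
-/
theorem tendsto_integral_fourier_of_vanishing {f : ℝ → ℂ} (hf : Integrable f) (h0 : f 0 = 0) {C : ℝ}
    (hC : ∀ᶠ x in 𝓝 (0 : ℝ), ‖f x‖ ≤ C * |x|) :
    Tendsto (fun T : ℝ => ∫ w in (-T)..T, 𝓕 f w) atTop (𝓝 0) := by
  have hθ := integrable_div_of_le_mul_abs hf hC
  set θ : ℝ → ℂ := fun x => f x / x with hθd
  have hpi : (2 * Real.pi * Complex.I : ℂ) ≠ 0 := Complex.two_pi_I_ne_zero
  have hxθ : (fun x : ℝ => x • θ x) = f := by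
    funext x
    rcases eq_or_ne x 0 with rfl | hx
    · simp [h0]
    · have : (x : ℂ) ≠ 0 := by exact_mod_cast hx
      simp only [hθd, Complex.real_smul]
      field_simp
  have hd : ∀ w : ℝ, HasDerivAt (fun w => (-(2 * Real.pi * Complex.I))⁻¹ * 𝓕 θ w) (𝓕 f w) w := by
    intro w
    have h1 := (Real.hasDerivAt_fourier hθ (by rw [hxθ]; exact hf) w).const_mul
      ((-(2 * Real.pi * Complex.I))⁻¹)
    convert! h1 using 1
    rw [Real.fourier_real_eq, Real.fourier_real_eq, ← integral_const_mul]
    refine integral_congr_ae (ae_of_all _ fun x => ?_)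
    have hx : f x = x * θ x := by rw [← Complex.real_smul]; exact (congrFun hxθ x).symm
    simp only [Circle.smul_def, smul_eq_mul, hx]
    field_simp
  have hc : Continuous (𝓕 f) :=
    VectorFourier.fourierIntegral_continuous Real.continuous_fourierChar
      (innerSL ℝ).continuous₂ hf
  have hI : ∀ T : ℝ, ∫ w in (-T)..T, 𝓕 f w =
      (-(2 * Real.pi * Complex.I))⁻¹ * 𝓕 θ T - (-(2 * Real.pi * Complex.I))⁻¹ * 𝓕 θ (-T) :=
    fun T => intervalIntegral.integral_eq_sub_of_hasDerivAt (fun w _ => hd w)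
      (hc.intervalIntegrable _ _)
  simp only [hI]
  have hz := Real.zero_at_infty_fourier θ
  have h1 : Tendsto (𝓕 θ) atTop (𝓝 0) := hz.mono_left atTop_le_cocompact
  have h2 : Tendsto (fun T => 𝓕 θ (-T)) atTop (𝓝 0) :=
    (hz.mono_left atBot_le_cocompact).comp tendsto_neg_atTop_atBot
  simpa using (h1.const_mul _).sub (h2.const_mul ((-(2 * Real.pi * Complex.I))⁻¹))

/-- Pointwise Fourier inversion under a Lipschitz condition at the point. -/
theorem tendsto_integral_fourier {f : ℝ → ℂ} (hf : Integrable f) {C : ℝ}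
    (hC : ∀ᶠ x in 𝓝 (0 : ℝ), ‖f x - f 0‖ ≤ C * |x|) :
    Tendsto (fun T : ℝ => ∫ w in (-T)..T, 𝓕 f w) atTop (𝓝 (f 0)) := by
  have hg : Integrable (fun x : ℝ => f 0 * Complex.exp (-Real.pi * x ^ 2)) :=
    integrable_pi_gaussian.const_mul _
  -- Subtracting `f 0` times the Gaussian `e^{-πx²}` makes the function vanish at `0`. The Gaussian
  -- is its own transform and has integral `1`, so inversion for it is immediate.
  have h1 := tendsto_integral_fourier_of_vanishing
    (f := fun x => f x - f 0 * Complex.exp (-Real.pi * x ^ 2)) (hf.sub hg) (by simp)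
    (C := C + ‖f 0‖ * Real.pi) (by
      filter_upwards [hC, Metric.ball_mem_nhds (0 : ℝ) one_pos] with x hx hx1
      have hx1 : |x| < 1 := by simpa using hx1
      have hx2 : x ^ 2 ≤ |x| := by rw [← sq_abs]; nlinarith [abs_nonneg x]
      calc ‖f x - f 0 * Complex.exp (-Real.pi * x ^ 2)‖
          = ‖(f x - f 0) + f 0 * (1 - Complex.exp (-Real.pi * x ^ 2))‖ := by ring_nf
        _ ≤ C * |x| + ‖f 0‖ * (Real.pi * |x|) := by
          refine (norm_add_le _ _).trans (add_le_add hx ?_)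
          rw [norm_mul]
          refine mul_le_mul_of_nonneg_left ?_ (norm_nonneg _)
          exact (norm_one_sub_pi_gaussian_le x).trans
            (mul_le_mul_of_nonneg_left hx2 Real.pi_pos.le)
        _ = (C + ‖f 0‖ * Real.pi) * |x| := by ring)
  have h2 : Tendsto (fun T : ℝ => ∫ w in (-T)..T, f 0 * Complex.exp (-Real.pi * w ^ 2)) atTop
      (𝓝 (f 0)) := by
    have := intervalIntegral_tendsto_integral hg tendsto_neg_atTop_atBot tendsto_id
    rwa [integral_const_mul, integral_pi_gaussian, mul_one] at this
  have hFg : 𝓕 (fun x : ℝ => f 0 * Complex.exp (-Real.pi * x ^ 2)) =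
      fun w : ℝ => f 0 * Complex.exp (-Real.pi * w ^ 2) := by
    funext w
    conv_rhs => rw [← congrFun fourier_pi_gaussian w]
    rw [Real.fourier_real_eq, Real.fourier_real_eq, ← integral_const_mul]
    refine integral_congr_ae (ae_of_all _ fun x => ?_)
    simp only [Circle.smul_def, smul_eq_mul]
    ring
  have hc : ∀ {f : ℝ → ℂ}, Integrable f → Continuous (𝓕 f) := fun hf =>
    VectorFourier.fourierIntegral_continuous Real.continuous_fourierChar
      (innerSL ℝ).continuous₂ hf
  have hconv : ∀ {g : ℝ → ℂ}, Integrable g → ∀ w : ℝ,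
      Integrable (fun v : ℝ => Real.fourierChar (-(v * w)) • g v) := fun hg w => by
    simpa [mul_comm w] using (Real.fourierIntegral_convergent_iff w).2 hg
  have hsub : Integrable (fun x : ℝ => f x - f 0 * Complex.exp (-Real.pi * x ^ 2)) := hf.sub hg
  have hF : ∀ w, 𝓕 f w = 𝓕 (fun x => f x - f 0 * Complex.exp (-Real.pi * x ^ 2)) w +
      f 0 * Complex.exp (-Real.pi * w ^ 2) := by
    intro w
    rw [← congrFun hFg w, Real.fourier_real_eq, Real.fourier_real_eq, Real.fourier_real_eq,
      ← integral_add]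
    · refine integral_congr_ae (ae_of_all _ fun x => ?_)
      simp only [← smul_add, sub_add_cancel]
    · exact hconv hsub w
    · exact hconv hg w
  have h3 := h1.add h2
  rw [zero_add] at h3
  refine h3.congr fun T => ?_
  rw [← intervalIntegral.integral_add ((hc hsub).intervalIntegrable _ _)
    (by apply Continuous.intervalIntegrable; fun_prop)]
  exact intervalIntegral.integral_congr fun w _ => (hF w).symm

/-- Pointwise Fourier inversion at a point `a`, in angular frequencies. -/
theorem tendsto_integral_integral_cexp {f : ℝ → ℂ} (hf : Integrable f) (a : ℝ) {C : ℝ}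
    (hC : ∀ᶠ x in 𝓝 a, ‖f x - f a‖ ≤ C * |x - a|) :
    Tendsto (fun R : ℝ => ∫ s in (-R)..R, ∫ x : ℝ, Complex.exp (-(Complex.I * s * (x - a))) * f x)
      atTop (𝓝 (2 * Real.pi * f a)) := by
  have hC' : ∀ᶠ x in 𝓝 (0 : ℝ), ‖f (x + a) - f (0 + a)‖ ≤ C * |x| := by
    have : Tendsto (fun x : ℝ => x + a) (𝓝 0) (𝓝 a) :=
      (continuous_id.add continuous_const).tendsto' _ _ (by simp)
    simpa using this.eventually hC
  have h := tendsto_integral_fourier (hf.comp_add_right a) hC'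
  -- `𝓕` uses the frequency `w` with `s = 2πw`, so the cutoff `R` in `s` is `R / (2π)` in `w`.
  have h2 : Tendsto (fun R : ℝ => R / (2 * Real.pi)) atTop atTop :=
    tendsto_id.atTop_div_const (by positivity)
  have h3 := ((h.comp h2).const_mul (2 * Real.pi : ℂ))
  rw [zero_add] at h3
  refine h3.congr fun R => ?_
  set Ψ : ℝ → ℂ := fun s => ∫ x : ℝ, Complex.exp (-(Complex.I * s * (x - a))) * f x with hΨ
  have hk : ∀ w : ℝ, 𝓕 (fun x => f (x + a)) w =
      Ψ (2 * Real.pi * w) := by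
    intro w
    rw [Real.fourier_real_eq_integral_exp_smul]
    simp only [Ψ]
    conv_rhs => rw [← integral_add_right_eq_self _ a]
    refine integral_congr_ae (ae_of_all _ fun x => ?_)
    dsimp only
    rw [smul_eq_mul]
    push_cast
    ring_nf
  simp only [Function.comp_apply, hk]
  rw [intervalIntegral.integral_comp_mul_left Ψ (by positivity : 2 * Real.pi ≠ 0),
    Complex.real_smul]
  have e : 2 * Real.pi * (R / (2 * Real.pi)) = R := by field_simp
  have hpi : (Real.pi : ℂ) ≠ 0 := by exact_mod_cast Real.pi_ne_zero
  rw [mul_neg, e, ← mul_assoc]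
  push_cast
  rw [mul_inv_cancel₀ (by simp [hpi]), one_mul]

end Fourier

/-! ### The sharp-switching limit for a stationary correlation. -/

section SharpSwitching

theorem deriv_zero_of_eventually_const {H H' : ℝ → ℝ} (hH : ∀ v, HasDerivAt H (H' v) v) {v c : ℝ}
    (h : ∀ᶠ x in 𝓝 v, H x = c) : H' v = 0 :=
  (hH v).unique ((hasDerivAt_const v c).congr_of_eventuallyEq h)

theorem integrable_of_continuous_of_compact {X : Type*} [TopologicalSpace X] [R1Space X]
    [MeasurableSpace X] [OpensMeasurableSpace X] {μ : Measure X} [IsFiniteMeasureOnCompacts μ]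
    {f : X → ℂ} (hf : Continuous f) {K : Set X} (hK : IsCompact K) (h : ∀ x ∉ K, f x = 0) :
    Integrable f μ :=
  hf.integrable_of_hasCompactSupport (HasCompactSupport.intro hK h)

/-- The integrand of the response after a switch-off profile `H`, with one of the two switch-off
factors allowed to be different. -/
def switchedIntegrand (φ H₁ H₂ : ℝ → ℝ) (k : ℝ → ℂ) (t : ℝ) (p : ℝ × ℝ) : ℂ :=
  ((φ p.1 * H₁ (t - p.1) : ℝ) : ℂ) * ((φ p.2 * H₂ (t - p.2) : ℝ) : ℂ) * k (p.1 - p.2)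

theorem continuous_switchedIntegrand {φ H₁ H₂ : ℝ → ℝ} {k : ℝ → ℂ} (hφ : Continuous φ)
    (h₁ : Continuous H₁) (h₂ : Continuous H₂) (hk : Continuous k) :
    Continuous (fun q : ℝ × (ℝ × ℝ) => switchedIntegrand φ H₁ H₂ k q.1 q.2) := by
  unfold switchedIntegrand
  fun_prop

theorem switchedIntegrand_eq_zero {φ H₁ H₂ : ℝ → ℝ} {k : ℝ → ℂ} {c e : ℝ}
    (hφ : ∀ u < c, φ u = 0) (h₁ : ∀ v < e, H₁ v = 0) (h₂ : ∀ v < e, H₂ v = 0) {t s : ℝ}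
    (hts : t ≤ s) {p : ℝ × ℝ} (hp : p ∉ Icc c (s - e) ×ˢ Icc c (s - e)) :
    switchedIntegrand φ H₁ H₂ k t p = 0 := by
  have key : ∀ {H : ℝ → ℝ}, (∀ v < e, H v = 0) → ∀ {u : ℝ}, u ∉ Icc c (s - e) →
      φ u * H (t - u) = 0 := by
    intro H hH u hu
    rw [mem_Icc, not_and_or, not_le, not_le] at hu
    rcases hu with hu | hu
    · rw [hφ u hu, zero_mul]
    · rw [hH _ (by linarith), mul_zero]
  rw [mem_prod, not_and_or] at hp
  unfold switchedIntegrand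
  rcases hp with hp | hp
  · rw [key h₁ hp]; simp
  · rw [key h₂ hp]; simp

theorem integrable_switchedIntegrand {φ H₁ H₂ : ℝ → ℝ} {k : ℝ → ℂ} {c e : ℝ}
    (hφc : Continuous φ) (hc₁ : Continuous H₁) (hc₂ : Continuous H₂) (hk : Continuous k)
    (hφ : ∀ u < c, φ u = 0) (h₁ : ∀ v < e, H₁ v = 0) (h₂ : ∀ v < e, H₂ v = 0) (t : ℝ) :
    Integrable (switchedIntegrand φ H₁ H₂ k t) :=
  integrable_of_continuous_of_compact
    ((continuous_switchedIntegrand hφc hc₁ hc₂ hk).comp (Continuous.prodMk_right t))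
    (isCompact_Icc.prod isCompact_Icc)
    (fun _ hp => switchedIntegrand_eq_zero hφ h₁ h₂ le_rfl hp)

/-- For `t` within distance `1` of `τ` the integrands all live on one compact square, where a
constant dominates the derivative. The product rule on the two switch-off factors gives the two
terms. -/
theorem hasDerivAt_integral_switchedIntegrand {φ H H' : ℝ → ℝ} {k : ℝ → ℂ} {c e : ℝ}
    (hφc : Continuous φ) (hH : ∀ v, HasDerivAt H (H' v) v) (hc' : Continuous H')
    (hk : Continuous k) (hφ : ∀ u < c, φ u = 0) (h0 : ∀ v < e, H v = 0) (τ : ℝ) :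
    HasDerivAt (fun t => ∫ p, switchedIntegrand φ H H k t p)
      ((∫ p, switchedIntegrand φ H' H k τ p) + ∫ p, switchedIntegrand φ H H' k τ p) τ := by
  have hc : Continuous H := continuous_iff_continuousAt.2 fun v => (hH v).continuousAt
  have h0' : ∀ v < e, H' v = 0 := fun v hv => deriv_zero_of_eventually_const hH
    ((eventually_lt_nhds hv).mono h0)
  have hcont := (continuous_switchedIntegrand hφc hc' hc hk).add
    (continuous_switchedIntegrand hφc hc hc' hk)
  set K : Set (ℝ × ℝ) := Icc c (τ + 1 - e) ×ˢ Icc c (τ + 1 - e) with hK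
  have hKc : IsCompact K := isCompact_Icc.prod isCompact_Icc
  obtain ⟨M, hM⟩ := ((isCompact_closedBall τ 1).prod hKc).exists_bound_of_continuousOn
    hcont.continuousOn
  have hI : ∀ t, Integrable (switchedIntegrand φ H H k t) :=
    integrable_switchedIntegrand hφc hc hc hk hφ h0 h0
  have hI₁ := integrable_switchedIntegrand hφc hc' hc hk hφ h0' h0 τ
  have hI₂ := integrable_switchedIntegrand hφc hc hc' hk hφ h0 h0' τ
  rw [← integral_add hI₁ hI₂]
  refine (hasDerivAt_integral_of_dominated_loc_of_deriv_le
    (Metric.closedBall_mem_nhds τ one_pos)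
    (F := switchedIntegrand φ H H k)
    (F' := fun t p => switchedIntegrand φ H' H k t p + switchedIntegrand φ H H' k t p)
    (bound := K.indicator fun _ => M)
    (Eventually.of_forall fun t => (hI t).aestronglyMeasurable) (hI τ)
    (hI₁.add hI₂).aestronglyMeasurable ?_ ?_ ?_).2
  · refine ae_of_all _ fun p t ht => ?_
    by_cases hp : p ∈ K
    · rw [indicator_of_mem hp]
      exact hM (t, p) ⟨ht, hp⟩
    · have hts : t ≤ τ + 1 := by
        have := abs_le.1 (by simpa [Real.dist_eq] using ht : |t - τ| ≤ 1)
        linarith [this.2]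
      rw [indicator_of_notMem hp, switchedIntegrand_eq_zero hφ h0' h0 hts hp,
        switchedIntegrand_eq_zero hφ h0 h0' hts hp]
      simp
  · rw [integrable_indicator_iff hKc.measurableSet]
    exact integrableOn_const hKc.measure_lt_top.ne
  · refine ae_of_all _ fun p t _ => ?_
    have d : ∀ u : ℝ, HasDerivAt (fun t : ℝ => ((φ u * H (t - u) : ℝ) : ℂ))
        ((φ u * H' (t - u) : ℝ) : ℂ) t := fun u =>
      (((hH (t - u)).comp_sub_const t u).const_mul (φ u)).ofReal_comp
    convert! ((d p.1).mul (d p.2)).mul_const (k (p.1 - p.2)) using 1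
    simp only [switchedIntegrand]
    ring

/-- Exchanging the two times reduces the second boundary term to the first, with the reflected
kernel. -/
theorem integral_switchedIntegrand_swap (φ H₁ H₂ : ℝ → ℝ) (k : ℝ → ℂ) (t : ℝ) :
    ∫ p, switchedIntegrand φ H₁ H₂ k t p =
      ∫ p, switchedIntegrand φ H₂ H₁ (fun s => k (-s)) t p := by
  rw [Measure.volume_eq_prod, ← integral_prod_swap]
  refine integral_congr_ae (ae_of_all _ fun p => ?_)
  simp only [switchedIntegrand, Prod.fst_swap, Prod.snd_swap, neg_sub]
  ring

namespace IsSwitchProfile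

variable {h : ℝ → ℝ}

theorem hasDerivAt (hh : IsSwitchProfile h) (x : ℝ) : HasDerivAt h (deriv h x) x :=
  (hh.smooth.differentiable (by simp) x).hasDerivAt

theorem continuous_deriv (hh : IsSwitchProfile h) : Continuous (deriv h) :=
  hh.smooth.continuous_deriv (by simp)

theorem apply_zero (hh : IsSwitchProfile h) : h 0 = 0 := by
  have hc : ContinuousWithinAt h (Iio 0) 0 := hh.smooth.continuous.continuousWithinAt
  refine tendsto_nhds_unique hc (tendsto_const_nhds.congr' ?_)
  filter_upwards [self_mem_nhdsWithin] with x hx using (hh.eq_zero x hx).symm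

theorem apply_one (hh : IsSwitchProfile h) : h 1 = 1 := by
  have hc : ContinuousWithinAt h (Ioi 1) 1 := hh.smooth.continuous.continuousWithinAt
  refine tendsto_nhds_unique hc (tendsto_const_nhds.congr' ?_)
  filter_upwards [self_mem_nhdsWithin] with x hx using (hh.eq_one x hx).symm

theorem deriv_eq_zero (hh : IsSwitchProfile h) {x : ℝ} (hx : x ∉ Icc (0 : ℝ) 1) :
    deriv h x = 0 := by
  rw [mem_Icc, not_and_or, not_le, not_le] at hx
  rcases hx with hx | hx
  · exact deriv_zero_of_eventually_const hh.hasDerivAt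
      ((eventually_lt_nhds hx).mono hh.eq_zero)
  · exact deriv_zero_of_eventually_const hh.hasDerivAt
      ((eventually_gt_nhds hx).mono hh.eq_one)

theorem integral_deriv (hh : IsSwitchProfile h) : ∫ x in (0 : ℝ)..1, deriv h x = 1 := by
  rw [intervalIntegral.integral_eq_sub_of_hasDerivAt (fun x _ => hh.hasDerivAt x)
    (hh.continuous_deriv.intervalIntegrable _ _), hh.apply_zero, hh.apply_one, sub_zero]

theorem exists_bound (hh : IsSwitchProfile h) : ∃ M, 0 ≤ M ∧ ∀ x, |h x| ≤ M := by
  obtain ⟨M, hM⟩ := (isCompact_Icc (a := (0 : ℝ)) (b := 1)).exists_bound_of_continuousOn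
    hh.smooth.continuous.continuousOn
  have h1 := hM 1 (by simp)
  rw [hh.apply_one, norm_one] at h1
  refine ⟨M, zero_le_one.trans h1, fun x => ?_⟩
  rcases lt_or_ge x 0 with hx | hx
  · rw [hh.eq_zero x hx, abs_zero]; linarith
  rcases lt_or_ge 1 x with hx1 | hx1
  · rw [hh.eq_one x hx1, abs_one]; exact h1
  · exact hM x ⟨hx, hx1⟩

end IsSwitchProfile

/-- The average of `k (τ + δ - δ w - b)` over the switch-off profile. -/
def switchAverage (h : ℝ → ℝ) (k : ℝ → ℂ) (τ : ℝ) (q : ℝ × ℝ) : ℂ :=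
  ∫ w in (0 : ℝ)..1, ((deriv h w : ℝ) : ℂ) * k (τ + q.1 - q.1 * w - q.2)

theorem continuous_switchAverage {h : ℝ → ℝ} (hh : IsSwitchProfile h) {k : ℝ → ℂ}
    (hk : Continuous k) (τ : ℝ) : Continuous (switchAverage h k τ) := by
  have hd := hh.continuous_deriv
  unfold switchAverage
  refine intervalIntegral.continuous_parametric_intervalIntegral_of_continuous' ?_ 0 1
  simp only [Function.uncurry_def]
  fun_prop

theorem switchAverage_zero {h : ℝ → ℝ} (hh : IsSwitchProfile h) (k : ℝ → ℂ) (τ b : ℝ) :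
    switchAverage h k τ (0, b) = k (τ - b) := by
  have : ∫ w in (0 : ℝ)..1, ((deriv h w : ℝ) : ℂ) = 1 := by
    rw [intervalIntegral.integral_ofReal, hh.integral_deriv, Complex.ofReal_one]
  simp only [switchAverage, zero_mul, add_zero, sub_zero]
  rw [intervalIntegral.integral_mul_const, this, one_mul]

/-- The derivative of the switch-off profile is an approximate delta at `τ`; the substitution `w =
(τ + δ - a) / δ` puts its mass on `[0, 1]` independently of `δ`. -/
theorem integral_switchOff {h₁ h₂ : ℝ → ℝ} (hh₁ : IsSwitchProfile h₁) (hh₂ : IsSwitchProfile h₂)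
    (k : ℝ → ℂ) {δ τ₀ τ : ℝ} (hδ : 0 < δ) (hτ : τ₀ < τ) (b : ℝ) :
    ∫ a, ((h₁ ((a - τ₀ + δ) / δ) * (deriv h₂ ((τ - a + δ) / δ) / δ) : ℝ) : ℂ) * k (a - b) =
      switchAverage h₂ k τ (δ, b) := by
  set G : ℝ → ℂ := fun w => ((deriv h₂ w : ℝ) : ℂ) * k (τ + δ - δ * w - b) with hG
  have e : ∀ a, ((h₁ ((a - τ₀ + δ) / δ) * (deriv h₂ ((τ - a + δ) / δ) / δ) : ℝ) : ℂ) * k (a - b) =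
      (δ : ℂ)⁻¹ * G ((τ + δ - a) / δ) := by
    intro a
    have e1 : τ - a + δ = τ + δ - a := by ring
    have e2 : τ + δ - δ * ((τ + δ - a) / δ) - b = a - b := by field_simp; ring
    simp only [hG]
    rw [e1, e2]
    by_cases hx : (τ + δ - a) / δ ∈ Icc (0 : ℝ) 1
    -- On this support `a ≥ τ > τ₀`, so the switch-on factor has already reached `1`.
    · have ha : τ ≤ a := by
        have := (div_le_one hδ).1 hx.2
        linarith
      rw [hh₁.eq_one _ (by rw [one_lt_div hδ]; linarith), one_mul]
      push_cast
      ring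
    · rw [hh₂.deriv_eq_zero hx]
      simp
  simp only [e]
  rw [integral_const_mul, integral_sub_left_eq_self (fun x => G (x / δ)) volume (τ + δ),
    Measure.integral_comp_div, abs_of_pos hδ, Complex.real_smul, ← mul_assoc,
    inv_mul_cancel₀ (by exact_mod_cast hδ.ne'), one_mul, switchAverage,
    intervalIntegral.integral_of_le zero_le_one, ← integral_Icc_eq_integral_Ioc]
  refine (setIntegral_eq_integral_of_forall_compl_eq_zero fun w hw => ?_).symm
  simp only [hG]
  rw [hh₂.deriv_eq_zero hw, Complex.ofReal_zero, zero_mul]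

theorem eventually_switching_eq {h₁ h₂ : ℝ → ℝ} (hh₁ : IsSwitchProfile h₁) (hh₂ : IsSwitchProfile h₂)
    {τ₀ τ b : ℝ} (h0 : b ≠ τ₀) (h1 : b ≠ τ) :
    ∀ᶠ δ in 𝓝[>] (0 : ℝ), switching h₁ h₂ δ τ₀ τ b = (Ioc τ₀ τ).indicator 1 b := by
  rcases lt_or_gt_of_ne h0 with h | h
  · filter_upwards [Ioo_mem_nhdsGT (sub_pos.2 h)] with δ hδ
    rw [indicator_of_notMem (fun hb => h.not_gt hb.1), switching,
      hh₁.eq_zero _ (div_neg_of_neg_of_pos (by linarith [hδ.2]) hδ.1), zero_mul]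
  rcases lt_or_gt_of_ne h1 with h' | h'
  · filter_upwards [self_mem_nhdsWithin] with δ (hδ : 0 < δ)
    rw [indicator_of_mem (show b ∈ Ioc τ₀ τ from ⟨h, h'.le⟩), switching,
      hh₁.eq_one _ (by rw [one_lt_div hδ]; linarith),
      hh₂.eq_one _ (by rw [one_lt_div hδ]; linarith)]
    simp
  · filter_upwards [Ioo_mem_nhdsGT (sub_pos.2 h')] with δ hδ
    rw [indicator_of_notMem (fun hb => h'.not_ge hb.2), switching,
      hh₂.eq_zero _ (div_neg_of_neg_of_pos (by linarith [hδ.2]) hδ.1), mul_zero]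

theorem tendsto_integral_switching_mul {h₁ h₂ : ℝ → ℝ} (hh₁ : IsSwitchProfile h₁)
    (hh₂ : IsSwitchProfile h₂) {J : ℝ × ℝ → ℂ} (hJ : Continuous J) {τ₀ τ : ℝ} (hτ : τ₀ ≤ τ) :
    Tendsto (fun δ => ∫ b, (switching h₁ h₂ δ τ₀ τ b : ℂ) * J (δ, b)) (𝓝[>] 0)
      (𝓝 (∫ b in τ₀..τ, J (0, b))) := by
  obtain ⟨M₁, hM₁, hb₁⟩ := hh₁.exists_bound
  obtain ⟨M₂, hM₂, hb₂⟩ := hh₂.exists_bound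
  set K := Icc (τ₀ - 1) (τ + 1) with hK
  obtain ⟨M, hM⟩ := ((isCompact_Icc (a := (0 : ℝ)) (b := 1)).prod
    (isCompact_Icc (a := τ₀ - 1) (b := τ + 1))).exists_bound_of_continuousOn hJ.continuousOn
  have hc₁ := hh₁.smooth.continuous
  have hc₂ := hh₂.smooth.continuous
  rw [intervalIntegral.integral_of_le hτ, ← integral_indicator measurableSet_Ioc]
  refine tendsto_integral_filter_of_dominated_convergence (K.indicator fun _ => M₁ * M₂ * M)
    (Eventually.of_forall fun δ => ?_) ?_ ?_ ?_
  · apply Continuous.aestronglyMeasurable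
    unfold switching
    fun_prop
  · filter_upwards [Ioo_mem_nhdsGT (zero_lt_one (α := ℝ))] with δ hδ
    refine ae_of_all _ fun b => ?_
    by_cases hb : b ∈ K
    · rw [indicator_of_mem hb, norm_mul, Complex.norm_real, switching, norm_mul]
      gcongr
      · exact hb₁ _
      · exact hb₂ _
      · exact hM (δ, b) ⟨Ioo_subset_Icc_self hδ, hb⟩
    · rw [indicator_of_notMem hb]
      rw [hK, mem_Icc, not_and_or, not_le, not_le] at hb
      have : switching h₁ h₂ δ τ₀ τ b = 0 := by
        rcases hb with hb | hb
        · rw [switching, hh₁.eq_zero _ (div_neg_of_neg_of_pos (by linarith [hδ.2]) hδ.1), zero_mul]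
        · rw [switching, hh₂.eq_zero _ (div_neg_of_neg_of_pos (by linarith [hδ.2]) hδ.1), mul_zero]
      simp [this]
  · rw [integrable_indicator_iff measurableSet_Icc]
    exact integrableOn_const isCompact_Icc.measure_lt_top.ne
  · have hne : ∀ c : ℝ, ∀ᵐ b : ℝ, b ≠ c := fun c => by
      simp [ae_iff]
    filter_upwards [hne τ₀, hne τ] with b h0 h1
    have hJb : Tendsto (fun δ : ℝ => J (δ, b)) (𝓝[>] 0) (𝓝 (J (0, b))) :=
      ((hJ.comp (Continuous.prodMk_left b)).tendsto 0).mono_left nhdsWithin_le_nhds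
    have hlim := hJb.const_mul (((Ioc τ₀ τ).indicator (1 : ℝ → ℝ) b : ℝ) : ℂ)
    have e : (Ioc τ₀ τ).indicator (fun b => J (0, b)) b =
        (((Ioc τ₀ τ).indicator (1 : ℝ → ℝ) b : ℝ) : ℂ) * J (0, b) := by
      by_cases hb : b ∈ Ioc τ₀ τ <;> simp [hb]
    rw [e]
    refine hlim.congr' ?_
    filter_upwards [eventually_switching_eq hh₁ hh₂ h0 h1] with δ hδ
    rw [hδ]

/-- Varying `τ` moves only the switch-off, so the derivative has one term for each switch-off
factor. As `δ → 0⁺` they tend to the integrals of `k (τ - b)` and `k (b - τ)` over `b ∈ [τ₀, τ]`,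
the two halves of the symmetric interval. No divergence arises, because the regularised kernel is
continuous. -/
theorem hasSharpRate_of_stationary {A : ℝ → ℝ → ℂ} {A₀ : ℝ → ℂ} (hA : ∀ a b, A a b = A₀ (a - b))
    (hA₀ : Continuous A₀) {h₁ h₂ : ℝ → ℝ} (hh₁ : IsSwitchProfile h₁) (hh₂ : IsSwitchProfile h₂)
    (E : ℝ) {τ₀ τ : ℝ} (hτ : τ₀ < τ) :
    HasSharpRate A h₁ h₂ E τ₀ τ (∫ s in (-(τ - τ₀))..(τ - τ₀),
      Complex.exp (-Complex.I * (E : ℂ) * (s : ℂ)) * A₀ s) := by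
  set k : ℝ → ℂ := fun s => Complex.exp (-Complex.I * (E : ℂ) * (s : ℂ)) * A₀ s with hkd
  have hk : Continuous k := by fun_prop
  have hk' : Continuous fun s => k (-s) := by fun_prop
  have hc₁ := hh₁.smooth.continuous
  have hc₂ := hh₂.smooth.continuous
  have hcd := hh₂.continuous_deriv
  refine ⟨fun δ => (∫ b, (switching h₁ h₂ δ τ₀ τ b : ℂ) * switchAverage h₂ k τ (δ, b)) +
    ∫ b, (switching h₁ h₂ δ τ₀ τ b : ℂ) * switchAverage h₂ (fun s => k (-s)) τ (δ, b), ?_, ?_⟩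
  · intro δ hδ
    set φ : ℝ → ℝ := fun u => h₁ ((u - τ₀ + δ) / δ) with hφ
    set H : ℝ → ℝ := fun v => h₂ ((v + δ) / δ) with hHd
    set H' : ℝ → ℝ := fun v => deriv h₂ ((v + δ) / δ) / δ with hH'd
    have hφc : Continuous φ := by fun_prop
    have hHc : Continuous H := by fun_prop
    have hH'c : Continuous H' := by fun_prop
    have hH : ∀ v, HasDerivAt H (H' v) v := by
      intro v
      have h1 : HasDerivAt (fun v : ℝ => (v + δ) / δ) (1 / δ) v :=
        ((hasDerivAt_id v).add_const δ).div_const δ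
      convert! (hh₂.hasDerivAt ((v + δ) / δ)).comp v h1 using 1
      simp only [hH'd]
      ring
    have hφ0 : ∀ u < τ₀ - δ, φ u = 0 := fun u hu =>
      hh₁.eq_zero _ (div_neg_of_neg_of_pos (by linarith) hδ)
    have hH0 : ∀ v < -δ, H v = 0 := fun v hv =>
      hh₂.eq_zero _ (div_neg_of_neg_of_pos (by linarith) hδ)
    have hH0' : ∀ v < -δ, H' v = 0 := fun v hv => deriv_zero_of_eventually_const hH
      ((eventually_lt_nhds hv).mono hH0)
    have hsw : ∀ t u, switching h₁ h₂ δ τ₀ t u = φ u * H (t - u) := by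
      intro t u
      simp only [switching, hφ, hHd]
      rw [show -u + t + δ = t - u + δ by ring]
    have hresp : (fun t => response A E (switching h₁ h₂ δ τ₀ t)) =
        fun t => ∫ p, switchedIntegrand φ H H k t p := by
      funext t
      rw [Measure.volume_eq_prod, integral_prod _
        (integrable_switchedIntegrand hφc hHc hHc hk hφ0 hH0 hH0 t)]
      simp only [response, switchedIntegrand, hsw, hA, hkd, mul_assoc]
    have hav : ∀ {k : ℝ → ℂ}, Continuous k → ∫ p, switchedIntegrand φ H' H k τ p =
        ∫ b, (switching h₁ h₂ δ τ₀ τ b : ℂ) * switchAverage h₂ k τ (δ, b) := by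
      intro k hk
      rw [Measure.volume_eq_prod, integral_prod_symm _
        (integrable_switchedIntegrand hφc hH'c hHc hk hφ0 hH0' hH0 τ)]
      refine integral_congr_ae (ae_of_all _ fun b => ?_)
      dsimp only
      rw [← integral_switchOff hh₁ hh₂ k hδ hτ b, ← integral_const_mul]
      refine integral_congr_ae (ae_of_all _ fun a => ?_)
      simp only [switchedIntegrand, hsw, hφ, hH'd]
      ring
    rw [hresp]
    dsimp only
    rw [← hav hk, ← hav hk', ← integral_switchedIntegrand_swap]
    exact hasDerivAt_integral_switchedIntegrand hφc hH hH'c hk hφ0 hH0 τ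
  · have hlim := (tendsto_integral_switching_mul hh₁ hh₂
      (continuous_switchAverage hh₂ hk τ) hτ.le).add
      (tendsto_integral_switching_mul hh₁ hh₂ (continuous_switchAverage hh₂ hk' τ) hτ.le)
    convert hlim using 2
    simp only [switchAverage_zero hh₂, neg_sub]
    rw [intervalIntegral.integral_comp_sub_left (fun x => k x), sub_self,
      intervalIntegral.integral_comp_sub_right (fun x => k x), sub_self, add_comm,
      intervalIntegral.integral_add_adjacent_intervals (hk.intervalIntegrable _ _)
        (hk.intervalIntegrable _ _)]

end SharpSwitching

/-! ### Spectral form of the massive correlation. -/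

section Correlation

/-- The chain rule contributes `-i` from the second time and `i` from the first; their product is
`1`. -/
theorem derivCorrelation_eq_of_hasDerivAt {W : Point → Point → ℂ} {γ : ℝ → Point} {ε : ℝ}
    {G G' G'' : ℂ → ℂ} (hε : 0 < ε) (hW : ∀ a b : ℝ, W (γ a) (γ b) = G (ε + Complex.I * (a - b)))
    (hG : ∀ ζ : ℂ, 0 < ζ.re → HasDerivAt G (G' ζ) ζ)
    (hG' : ∀ ζ : ℂ, 0 < ζ.re → HasDerivAt G' (G'' ζ) ζ) (a b : ℝ) :
    derivCorrelation W γ a b = G'' (ε + Complex.I * (a - b)) := by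
  have hre : ∀ a b : ℝ, 0 < ((ε : ℂ) + Complex.I * (a - b)).re := fun a b => by simpa using hε
  have d1 : ∀ a b : ℝ, HasDerivAt (fun b' : ℝ => W (γ a) (γ b'))
      (G' (ε + Complex.I * (a - b)) * -Complex.I) b := by
    intro a b
    have h1 : HasDerivAt (fun b : ℝ => (ε : ℂ) + Complex.I * (a - b)) (-Complex.I) b := by
      simpa using
        (((Complex.ofRealCLM.hasDerivAt (x := b)).const_sub (a : ℂ)).const_mul
          Complex.I).const_add (ε : ℂ)
    simp only [hW]
    exact (hG _ (hre a b)).comp b h1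
  have d2 : HasDerivAt (fun a : ℝ => G' (ε + Complex.I * (a - b)) * -Complex.I)
      (G'' (ε + Complex.I * (a - b)) * Complex.I * -Complex.I) a := by
    have h1 : HasDerivAt (fun a : ℝ => (ε : ℂ) + Complex.I * (a - b)) Complex.I a := by
      simpa using
        (((Complex.ofRealCLM.hasDerivAt (x := a)).sub_const (b : ℂ)).const_mul
          Complex.I).const_add (ε : ℂ)
    exact ((hG' _ (hre a b)).comp a h1).mul_const _
  unfold derivCorrelation
  simp only [(d1 _ _).deriv]
  rw [d2.deriv, mul_assoc, mul_neg, Complex.I_mul_I, neg_neg, mul_one]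

/-- Since `ε + i(t - s) = i(t - s - iε)`, the radicand is `ζ² + Δx²`, which splits into light-cone
factors of positive real part when `ε > 0`. -/
theorem regDist_eq (ε t x s y : ℝ) :
    regDist ε (t, x) (s, y) =
      ((ε + Complex.I * (t - s) - Complex.I * (x - y : ℝ)) *
        (ε + Complex.I * (t - s) + Complex.I * (x - y : ℝ))) ^ (1 / 2 : ℂ) := by
  unfold regDist
  congr 1
  push_cast
  linear_combination (((x : ℂ) - y) ^ 2 - ((t : ℂ) - s) ^ 2 - (ε : ℂ) ^ 2) * Complex.I_sq

theorem ofReal_mul_sqrt {m : ℝ} (hm : 0 < m) {x : ℂ} (hx : x ≠ 0) :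
    (m : ℂ) * x ^ (1 / 2 : ℂ) = ((m * m : ℝ) * x) ^ (1 / 2 : ℂ) := by
  have hmm : 0 < m * m := mul_pos hm hm
  have h0 : ((m * m : ℝ) : ℂ) * x ≠ 0 := mul_ne_zero (by exact_mod_cast hmm.ne') hx
  rw [Complex.cpow_def_of_ne_zero hx, Complex.cpow_def_of_ne_zero h0,
    Complex.log_ofReal_mul hmm hx, add_mul, Complex.exp_add, Real.log_mul hm.ne' hm.ne']
  congr 1
  rw [show ((Real.log m + Real.log m : ℝ) : ℂ) * (1 / 2) = (Real.log m : ℝ) by push_cast; ring,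
    ← Complex.ofReal_exp, Real.exp_log hm]

theorem log_ofReal_mul_sqrt_mul {μ : ℝ} (hμ : 0 < μ) {p q : ℂ} (hp : 0 < p.re) (hq : 0 < q.re) :
    Complex.log ((μ : ℂ) * (p * q) ^ (1 / 2 : ℂ)) =
      Real.log μ + (Complex.log p + Complex.log q) / 2 := by
  have hpq : p * q ≠ 0 := mul_ne_zero (ne_zero_of_re_pos hp) (ne_zero_of_re_pos hq)
  have hs := Complex.slitPlane_ne_zero (mul_mem_slitPlane hp hq)
  have him : ((Complex.log p + Complex.log q) / 2).im = (p.arg + q.arg) / 2 := by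
    rw [Complex.div_ofNat_im, Complex.add_im, Complex.log_im, Complex.log_im]
  have h := arg_add_arg_mem_Ioo hp hq
  rw [Complex.cpow_def_of_ne_zero hpq, log_mul_of_re_pos hp hq, mul_one_div,
    Complex.log_ofReal_mul hμ (Complex.exp_ne_zero _), Complex.log_exp]
  · rw [him]; linarith [h.1, Real.pi_pos]
  · rw [him]; linarith [h.2, Real.pi_pos]

/-- With `p, q = m(ζ ∓ iΔx)` the light-cone exponent is `-ζ m cosh u + i m Δx sinh u`; folding `u`
with `-u` turns the phase into a cosine. -/
theorem besselK0_mul_regDist {m ε : ℝ} (hm : 0 < m) (hε : 0 < ε) (t x s y : ℝ) :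
    besselK0 (m * regDist ε (t, x) (s, y)) =
      ∫ u in Ioi (0 : ℝ), ((Real.cos (m * (x - y) * Real.sinh u) : ℝ) : ℂ) *
        Complex.exp (-((ε + Complex.I * (t - s)) * (m * Real.cosh u : ℝ))) := by
  set ζ : ℂ := ε + Complex.I * (t - s) with hζ
  have hζre : 0 < ζ.re := by simpa [hζ] using hε
  set p := (m : ℂ) * (ζ - Complex.I * (x - y : ℝ)) with hp
  set q := (m : ℂ) * (ζ + Complex.I * (x - y : ℝ)) with hq
  have hpre : 0 < p.re := by
    rw [hp, Complex.re_ofReal_mul, Complex.sub_re, Complex.I_mul_re, Complex.ofReal_im]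
    simpa using mul_pos hm hζre
  have hqre : 0 < q.re := by
    rw [hq, Complex.re_ofReal_mul, Complex.add_re, Complex.I_mul_re, Complex.ofReal_im]
    simpa using mul_pos hm hζre
  have hpq : p * q = (m * m : ℝ) *
      ((ζ - Complex.I * (x - y : ℝ)) * (ζ + Complex.I * (x - y : ℝ))) := by
    rw [hp, hq]; push_cast; ring
  have h0 : (ζ - Complex.I * (x - y : ℝ)) * (ζ + Complex.I * (x - y : ℝ)) ≠ 0 := by
    intro h
    have := mul_ne_zero (ne_zero_of_re_pos hpre) (ne_zero_of_re_pos hqre)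
    rw [hpq, h, mul_zero] at this
    exact this rfl
  have h2 : 2 * besselK0 (m * regDist ε (t, x) (s, y)) = lightConeIntegral p q := by
    rw [regDist_eq, ofReal_mul_sqrt hm h0, ← hpq, lightConeIntegral_eq hpre hqre]
  rw [← mul_right_inj' (two_ne_zero (α := ℂ)), h2, lightConeIntegral,
    integral_eq_integral_Ioi_add_comp_neg (integrable_exp_lightCone hpre hqre),
    ← integral_const_mul]
  refine integral_congr_ae (ae_of_all _ fun u => ?_)
  dsimp only
  set c : ℂ := ((m * (x - y) * Real.sinh u : ℝ) : ℂ) with hc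
  have e1 : -((p * Real.exp u + q * Real.exp (-u)) / 2) =
      -(ζ * (m * Real.cosh u : ℝ)) + c * Complex.I := by
    rw [hp, hq, hc, Real.cosh_eq, Real.sinh_eq]
    push_cast
    ring
  have e2 : -((p * Real.exp (-u) + q * Real.exp (- -u)) / 2) =
      -(ζ * (m * Real.cosh u : ℝ)) + -c * Complex.I := by
    rw [hp, hq, hc, Real.cosh_eq, Real.sinh_eq, neg_neg]
    push_cast
    ring
  rw [e1, e2, Complex.exp_add, Complex.exp_add, Complex.ofReal_cos, ← hc, ← mul_assoc,
    Complex.two_cos]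
  ring

theorem Setting.abs_eta_le (S : Setting) : |S.eta| ≤ 1 := by
  cases S <;> simp [Setting.eta]

/-- The weight `1 + η cos (2 m d sinh u)` of rapidity `u`. -/
def rapidityWeight (S : Setting) (d m u : ℝ) : ℂ :=
  ((1 + S.eta * Real.cos (2 * d * (m * Real.sinh u)) : ℝ) : ℂ)

theorem laplaceIntegrable_rapidityWeight (S : Setting) (d : ℝ) {m : ℝ} (hm : 0 < m) :
    LaplaceIntegrable (volume.restrict (Ioi 0)) (fun u => m * Real.cosh u)
      (rapidityWeight S d m) := by
  refine (laplaceIntegrable_mul_cosh hm (Ioi 0) (w := fun _ => 1) continuous_const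
    (by simp)).of_norm_le (C := 2) ?_ fun u => ?_
  · apply Continuous.aestronglyMeasurable
    unfold rapidityWeight
    fun_prop
  · rw [rapidityWeight, Complex.norm_real, Real.norm_eq_abs, norm_one, mul_one]
    refine (abs_add_le _ _).trans ?_
    rw [abs_one, abs_mul]
    nlinarith [S.abs_eta_le, Real.abs_cos_le_one (2 * d * (m * Real.sinh u)), abs_nonneg S.eta]

theorem massiveWightman_static (S : Setting) (d : ℝ) {m ε : ℝ} (hm : 0 < m) (hε : 0 < ε)
    (a b : ℝ) :
    massiveWightman S m ε (staticWorldline d a) (staticWorldline d b) =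
      1 / (2 * (Real.pi : ℂ)) * ∫ u in Ioi (0 : ℝ), rapidityWeight S d m u *
        Complex.exp (-((ε + Complex.I * (a - b)) * (m * Real.cosh u : ℝ))) := by
  have hre : 0 < ((ε : ℂ) + Complex.I * (a - b)).re := by simpa using hε
  simp only [massiveWightman, staticWorldline, mirror]
  rw [besselK0_mul_regDist hm hε, besselK0_mul_regDist hm hε, div_eq_mul_one_div (S.eta : ℂ),
    mul_comm (S.eta : ℂ), mul_assoc, ← mul_add, ← integral_const_mul, ← integral_add]
  · congr 1
    refine integral_congr_ae (ae_of_all _ fun u => ?_)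
    simp only [rapidityWeight]
    rw [sub_self, mul_zero, zero_mul, Real.cos_zero,
      show m * (d - -d) * Real.sinh u = 2 * d * (m * Real.sinh u) by ring]
    push_cast
    ring
  · exact (laplaceIntegrable_mul_cosh hm _ (by fun_prop) (fun u => by
      rw [Complex.norm_real]; exact Real.abs_cos_le_one _)).integrable_mul_exp hre
  · exact ((laplaceIntegrable_mul_cosh hm _ (by fun_prop) (fun u => by
      rw [Complex.norm_real]; exact Real.abs_cos_le_one _)).integrable_mul_exp hre).const_mul _

theorem derivCorrelation_massive (S : Setting) (d : ℝ) {m ε : ℝ} (hm : 0 < m) (hε : 0 < ε)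
    (a b : ℝ) :
    derivCorrelation (massiveWightman S m ε) (staticWorldline d) a b =
      1 / (2 * (Real.pi : ℂ)) * ∫ u in Ioi (0 : ℝ),
        ((m * Real.cosh u : ℝ) : ℂ) ^ 2 * rapidityWeight S d m u *
        Complex.exp (-((ε + Complex.I * (a - b)) * (m * Real.cosh u : ℝ))) := by
  have hL := laplaceIntegrable_rapidityWeight S d hm
  rw [derivCorrelation_eq_of_hasDerivAt hε (massiveWightman_static S d hm hε)
    (fun ζ hζ => (hL.hasDerivAt hζ).const_mul _)
    (fun ζ hζ => (hL.neg_mul.hasDerivAt hζ).const_mul _)]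
  congr 1
  refine integral_congr_ae (ae_of_all _ fun u => ?_)
  dsimp only
  ring

/-- The correlation along `γ` is the Laplace transform of the rate function `ρ`. -/
structure HasSpectralRate (W : ℝ → Point → Point → ℂ) (γ : ℝ → Point) (ρ : ℝ → ℝ) : Prop where
  integrable : ∀ ε : ℝ, 0 < ε →
    Integrable (fun ν : ℝ => (ρ (-ν) : ℂ) * Complex.exp (-((ε : ℂ) * ν)))
  correlation_eq : ∀ ε : ℝ, 0 < ε → ∀ a b : ℝ, derivCorrelation (W ε) γ a b =
    1 / (2 * (Real.pi : ℂ)) *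
      ∫ ν : ℝ, (ρ (-ν) : ℂ) * Complex.exp (-((ε + Complex.I * (a - b)) * ν))

theorem image_mul_cosh {m : ℝ} (hm : 0 < m) :
    (fun u => m * Real.cosh u) '' Ioi 0 = Ioi m := by
  ext ν
  constructor
  · rintro ⟨u, hu, rfl⟩
    have : 1 < Real.cosh u := Real.one_lt_cosh.2 (ne_of_gt hu)
    exact (lt_mul_iff_one_lt_right hm).2 this
  · intro hν
    have h1 : 1 < ν / m := (one_lt_div hm).2 hν
    refine ⟨Real.arcosh (ν / m), Real.arcosh_pos h1, ?_⟩
    dsimp only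
    rw [Real.cosh_arcosh h1.le]
    field_simp

/-- The Jacobian `m sinh u` cancels the square root in the rate, which is why the threshold
singularity is integrable. -/
theorem massiveRate_neg_mul_cosh (S : Setting) (d : ℝ) {m u : ℝ} (hm : 0 < m) (hu : 0 < u) :
    |m * Real.sinh u| * massiveRate S d m (-(m * Real.cosh u)) =
      (m * Real.cosh u) ^ 2 * (1 + S.eta * Real.cos (2 * d * (m * Real.sinh u))) := by
  have hs : 0 < m * Real.sinh u := mul_pos hm (Real.sinh_pos_iff.2 hu)
  have hr : √((-(m * Real.cosh u)) ^ 2 - m ^ 2) = m * Real.sinh u := by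
    rw [show (-(m * Real.cosh u)) ^ 2 - m ^ 2 = (m * Real.sinh u) ^ 2 by
      rw [neg_sq, mul_pow, mul_pow, Real.cosh_sq]; ring]
    exact Real.sqrt_sq hs.le
  have hc : 1 < Real.cosh u := Real.one_lt_cosh.2 hu.ne'
  have hh : heaviside (- -(m * Real.cosh u) - m) = 1 := by
    rw [heaviside, if_pos (by nlinarith)]
  rw [massiveRate, hr, hh, abs_of_pos hs]
  field_simp

theorem massiveRate_neg_of_le (S : Setting) (d : ℝ) {m ν : ℝ} (h : ν ≤ m) :
    massiveRate S d m (-ν) = 0 := by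
  rw [massiveRate, heaviside, if_neg (by linarith), mul_zero]

theorem hasSpectralRate_massive (S : Setting) (d : ℝ) {m : ℝ} (hm : 0 < m) :
    HasSpectralRate (massiveWightman S m) (staticWorldline d) (massiveRate S d m) := by
  have hderiv : ∀ u ∈ Ioi (0 : ℝ), HasDerivWithinAt (fun u => m * Real.cosh u)
      (m * Real.sinh u) (Ioi 0) u := fun u _ =>
    ((Real.hasDerivAt_cosh u).const_mul m).hasDerivWithinAt
  have hinj : InjOn (fun u => m * Real.cosh u) (Ioi 0) := by
    intro u hu v hv h
    have h1 := Real.cosh_le_cosh.1 (mul_left_cancel₀ hm.ne' h).le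
    have h2 := Real.cosh_le_cosh.1 (mul_left_cancel₀ hm.ne' h).ge
    rw [abs_of_pos (mem_Ioi.1 hu), abs_of_pos (mem_Ioi.1 hv)] at h1 h2
    exact le_antisymm h1 h2
  have hsub : ∀ ζ : ℂ, ∀ u ∈ Ioi (0 : ℝ), |m * Real.sinh u| •
      ((massiveRate S d m (-(m * Real.cosh u)) : ℂ) *
        Complex.exp (-(ζ * (m * Real.cosh u : ℝ)))) =
      ((m * Real.cosh u : ℝ) : ℂ) ^ 2 * rapidityWeight S d m u *
        Complex.exp (-(ζ * (m * Real.cosh u : ℝ))) := by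
    intro ζ u hu
    rw [Complex.real_smul, ← mul_assoc, ← Complex.ofReal_mul, massiveRate_neg_mul_cosh S d hm hu,
      rapidityWeight]
    push_cast
    rfl
  have hzero : ∀ ζ : ℂ, ∀ ν ∉ Ioi m,
      (massiveRate S d m (-ν) : ℂ) * Complex.exp (-(ζ * ν)) = 0 := by
    intro ζ ν hν
    rw [massiveRate_neg_of_le S d (not_lt.1 hν), Complex.ofReal_zero, zero_mul]
  refine ⟨fun ε hε => ?_, fun ε hε a b => ?_⟩
  -- Two applications of `neg_mul` put the factor `(m cosh u)²` into the weight, the signs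
  -- cancelling.
  · have hL := (laplaceIntegrable_rapidityWeight S d hm).neg_mul.neg_mul.integrable_mul_exp
      (z := ε) (by simpa using hε)
    rw [← integrableOn_iff_integrable_of_support_subset (s := Ioi m)
      (fun ν hν => by_contra fun h => hν (hzero ε ν h)), ← image_mul_cosh hm,
      integrableOn_image_iff_integrableOn_abs_deriv_smul measurableSet_Ioi hderiv hinj]
    refine IntegrableOn.congr_fun hL (fun u hu => ?_) measurableSet_Ioi
    rw [hsub ε u hu]
    ring
  · rw [derivCorrelation_massive S d hm hε,
      ← setIntegral_eq_integral_of_forall_compl_eq_zero (hzero _), ← image_mul_cosh hm,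
      integral_image_eq_integral_abs_deriv_smul measurableSet_Ioi hderiv hinj]
    congr 1
    exact setIntegral_congr_fun measurableSet_Ioi fun u hu => (hsub _ u hu).symm

end Correlation

/-! ### Spectral form of the massless correlation. -/

section Massless

theorem log_hasDerivAt_of_re_pos {f : ℂ → ℂ} {ζ : ℂ} (hf : HasDerivAt f 1 ζ) (h : 0 < (f ζ).re) :
    HasDerivAt (fun z => Complex.log (f z)) ((f ζ)⁻¹) ζ := by
  simpa using hf.clog (Complex.mem_slitPlane_iff.2 (Or.inl h))

theorem inv_hasDerivAt_of_re_pos {f : ℂ → ℂ} {ζ : ℂ} (hf : HasDerivAt f 1 ζ) (h : 0 < (f ζ).re) :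
    HasDerivAt (fun z => (f z)⁻¹) (-(1 / f ζ ^ 2)) ζ := by
  convert! hf.fun_inv (ne_zero_of_re_pos h) using 1
  ring

/-- The constant `μ` enters only through the additive `log μ`, which the derivatives remove. -/
theorem masslessWightman_static (S : Setting) (d : ℝ) {μ ε : ℝ} (hμ : 0 < μ) (hε : 0 < ε)
    (a b : ℝ) :
    masslessWightman S μ ε (staticWorldline d a) (staticWorldline d b) =
      -(1 / (2 * (Real.pi : ℂ))) * (Real.log μ + Complex.log (ε + Complex.I * (a - b))) -
        (S.eta : ℂ) / (2 * (Real.pi : ℂ)) * (Real.log μ +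
          (Complex.log (ε + Complex.I * (a - b) - Complex.I * (2 * d : ℝ)) +
            Complex.log (ε + Complex.I * (a - b) + Complex.I * (2 * d : ℝ))) / 2) := by
  simp only [masslessWightman, staticWorldline, mirror]
  rw [regDist_eq, regDist_eq, log_ofReal_mul_sqrt_mul hμ (by simpa using hε) (by simpa using hε),
    log_ofReal_mul_sqrt_mul hμ (by simpa using hε) (by simpa using hε),
    show d - -d = 2 * d by ring]
  simp

theorem derivCorrelation_massless (S : Setting) (d : ℝ) {μ ε : ℝ} (hμ : 0 < μ) (hε : 0 < ε)
    (a b : ℝ) :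
    derivCorrelation (masslessWightman S μ ε) (staticWorldline d) a b =
      1 / (2 * (Real.pi : ℂ)) * (1 / (ε + Complex.I * (a - b)) ^ 2 +
        S.eta * (1 / (ε + Complex.I * (a - b) - Complex.I * (2 * d : ℝ)) ^ 2 +
          1 / (ε + Complex.I * (a - b) + Complex.I * (2 * d : ℝ)) ^ 2) / 2) := by
  have hm : ∀ ζ : ℂ, HasDerivAt (fun ζ : ℂ => ζ - Complex.I * (2 * d : ℝ)) 1 ζ :=
    fun ζ => (hasDerivAt_id ζ).sub_const _
  have hp : ∀ ζ : ℂ, HasDerivAt (fun ζ : ℂ => ζ + Complex.I * (2 * d : ℝ)) 1 ζ :=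
    fun ζ => (hasDerivAt_id ζ).add_const _
  have hmr : ∀ ζ : ℂ, 0 < ζ.re → 0 < (ζ - Complex.I * (2 * d : ℝ)).re :=
    fun ζ hζ => by simpa using hζ
  have hpr : ∀ ζ : ℂ, 0 < ζ.re → 0 < (ζ + Complex.I * (2 * d : ℝ)).re :=
    fun ζ hζ => by simpa using hζ
  rw [derivCorrelation_eq_of_hasDerivAt hε (masslessWightman_static S d hμ hε)
    (fun ζ hζ =>
      (((log_hasDerivAt_of_re_pos (hasDerivAt_id ζ) hζ).const_add _).const_mul _).fun_sub
      ((((((log_hasDerivAt_of_re_pos (hm ζ) (hmr ζ hζ)).fun_add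
        (log_hasDerivAt_of_re_pos (hp ζ) (hpr ζ hζ))).div_const 2)).const_add _).const_mul _))
    (fun ζ hζ =>
      ((inv_hasDerivAt_of_re_pos (hasDerivAt_id ζ) hζ).const_mul _).fun_sub
      (((((inv_hasDerivAt_of_re_pos (hm ζ) (hmr ζ hζ)).fun_add
        (inv_hasDerivAt_of_re_pos (hp ζ) (hpr ζ hζ))).div_const 2)).const_mul _))]
  simp only [id]
  ring

theorem integrableOn_mul_exp_neg {p : ℂ} (hp : 0 < p.re) :
    IntegrableOn (fun ν : ℝ => (ν : ℂ) * Complex.exp (-(p * ν))) (Ioi 0) := by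
  refine ((exp_neg_integrableOn_Ioi 0 (half_pos hp)).const_mul (2 / p.re)).mono'
    (by fun_prop) ?_
  refine (ae_restrict_iff' measurableSet_Ioi).2 (ae_of_all _ fun ν (hν : 0 < ν) => ?_)
  rw [norm_mul_cexp_neg_mul, Complex.norm_real, Real.norm_of_nonneg hν.le]
  simpa using mul_exp_neg_mul_le hp ν

theorem integral_mul_exp_neg {p : ℂ} (hp : 0 < p.re) :
    ∫ ν in Ioi (0 : ℝ), (ν : ℂ) * Complex.exp (-(p * ν)) = 1 / p ^ 2 := by
  have hp0 := ne_zero_of_re_pos hp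
  have ht : ∀ {c : ℝ}, 0 < c → Tendsto (fun ν : ℝ => Real.exp (-(c * ν))) atTop (𝓝 0) :=
    fun hc => Real.tendsto_exp_neg_atTop_nhds_zero.comp (tendsto_id.const_mul_atTop hc)
  have t1 : Tendsto (fun ν : ℝ => Complex.exp (-(p * ν))) atTop (𝓝 0) := by
    refine squeeze_zero_norm (fun ν => le_of_eq ?_) (ht hp)
    simpa using norm_mul_cexp_neg_mul 1 p ν
  have t2 : Tendsto (fun ν : ℝ => (ν : ℂ) * Complex.exp (-(p * ν))) atTop (𝓝 0) := by
    have h := (ht (half_pos hp)).const_mul (2 / p.re)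
    rw [mul_zero] at h
    refine squeeze_zero_norm' ?_ h
    filter_upwards [eventually_ge_atTop 0] with ν hν
    rw [norm_mul_cexp_neg_mul, Complex.norm_real, Real.norm_of_nonneg hν]
    exact mul_exp_neg_mul_le hp ν
  -- The primitive comes from one integration by parts.
  have hd : ∀ ν : ℝ, HasDerivAt (fun ν : ℝ => -p⁻¹ * (ν * Complex.exp (-(p * ν))) -
      p⁻¹ ^ 2 * Complex.exp (-(p * ν))) ((ν : ℂ) * Complex.exp (-(p * ν))) ν := by
    intro ν
    have h0 : HasDerivAt (fun ν : ℝ => (ν : ℂ)) 1 ν := Complex.ofRealCLM.hasDerivAt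
    have h1 : HasDerivAt (fun ν : ℝ => Complex.exp (-(p * ν)))
        (Complex.exp (-(p * ν)) * -(p * 1)) ν := ((h0.const_mul p).fun_neg).cexp
    convert! ((h0.mul h1).const_mul (-p⁻¹)).sub (h1.const_mul (p⁻¹ ^ 2)) using 1
    field_simp
    ring
  have h := integral_Ioi_of_hasDerivAt_of_tendsto' (a := 0) (fun ν _ => hd ν)
    (integrableOn_mul_exp_neg hp) ((t2.const_mul (-p⁻¹)).sub (t1.const_mul (p⁻¹ ^ 2)))
  rw [h]
  simp

theorem masslessRate_neg_of_pos (S : Setting) (d : ℝ) {ν : ℝ} (hν : 0 < ν) :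
    masslessRate S d (-ν) = ν * (1 + S.eta * Real.cos (2 * d * ν)) := by
  rw [masslessRate, heaviside, if_pos (by simpa using hν), neg_neg, mul_one, mul_neg,
    Real.cos_neg]

theorem masslessRate_neg_of_nonpos (S : Setting) (d : ℝ) {ν : ℝ} (hν : ν ≤ 0) :
    masslessRate S d (-ν) = 0 := by
  rw [masslessRate, heaviside, if_neg (by simpa using hν), mul_zero]

/-- Writing `cos(2dν)` as exponentials shifts `ζ` by `∓2di`, so every term is a Laplace transform of
`ν`. -/
theorem hasSpectralRate_massless (S : Setting) (d : ℝ) {μ : ℝ} (hμ : 0 < μ) :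
    HasSpectralRate (masslessWightman S μ) (staticWorldline d) (masslessRate S d) := by
  have hzero : ∀ ζ : ℂ, ∀ ν ∉ Ioi (0 : ℝ),
      (masslessRate S d (-ν) : ℂ) * Complex.exp (-(ζ * ν)) = 0 := by
    intro ζ ν hν
    rw [masslessRate_neg_of_nonpos S d (not_lt.1 hν), Complex.ofReal_zero, zero_mul]
  have hEq : ∀ ζ : ℂ, ∀ ν ∈ Ioi (0 : ℝ),
      (masslessRate S d (-ν) : ℂ) * Complex.exp (-(ζ * ν)) =
      (ν : ℂ) * Complex.exp (-(ζ * ν)) + S.eta / 2 *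
        ((ν : ℂ) * Complex.exp (-((ζ - Complex.I * (2 * d : ℝ)) * ν)) +
          (ν : ℂ) * Complex.exp (-((ζ + Complex.I * (2 * d : ℝ)) * ν))) := by
    intro ζ ν hν
    set c : ℂ := ((2 * d * ν : ℝ) : ℂ) with hc
    have e1 : -((ζ - Complex.I * (2 * d : ℝ)) * ν) = -(ζ * ν) + c * Complex.I := by
      rw [hc]; push_cast; ring
    have e2 : -((ζ + Complex.I * (2 * d : ℝ)) * ν) = -(ζ * ν) + -c * Complex.I := by
      rw [hc]; push_cast; ring
    rw [masslessRate_neg_of_pos S d hν, e1, e2, Complex.exp_add, Complex.exp_add]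
    have h2 := Complex.two_cos c
    push_cast at hc ⊢
    rw [← hc]
    linear_combination (S.eta / 2 * ν * Complex.exp (-(ζ * ν))) * h2
  have hmr : ∀ {ζ : ℂ}, 0 < ζ.re → 0 < (ζ - Complex.I * (2 * d : ℝ)).re :=
    fun hζ => by simpa using hζ
  have hpr : ∀ {ζ : ℂ}, 0 < ζ.re → 0 < (ζ + Complex.I * (2 * d : ℝ)).re :=
    fun hζ => by simpa using hζ
  refine ⟨fun ε hε => ?_, fun ε hε a b => ?_⟩
  · have hε' : 0 < (ε : ℂ).re := by simpa using hε
    rw [← integrableOn_iff_integrable_of_support_subset (s := Ioi 0)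
      (fun ν hν => by_contra fun h => hν (hzero ε ν h)),
      integrableOn_congr_fun (hEq ε) measurableSet_Ioi]
    exact (integrableOn_mul_exp_neg hε').add (((integrableOn_mul_exp_neg (hmr hε')).add
      (integrableOn_mul_exp_neg (hpr hε'))).const_mul _)
  · have hζ : 0 < ((ε : ℂ) + Complex.I * (a - b)).re := by simpa using hε
    have i1 := integrableOn_mul_exp_neg (hmr hζ)
    have i2 := integrableOn_mul_exp_neg (hpr hζ)
    have i12 : IntegrableOn (fun ν : ℝ =>
        (ν : ℂ) * Complex.exp (-((ε + Complex.I * (a - b) - Complex.I * (2 * d : ℝ)) * ν)) +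
          (ν : ℂ) * Complex.exp (-((ε + Complex.I * (a - b) + Complex.I * (2 * d : ℝ)) * ν)))
        (Ioi 0) := i1.add i2
    rw [derivCorrelation_massless S d hμ hε,
      ← setIntegral_eq_integral_of_forall_compl_eq_zero (hzero _),
      setIntegral_congr_fun measurableSet_Ioi (hEq _),
      integral_add (integrableOn_mul_exp_neg hζ) (i12.const_mul _), integral_const_mul,
      integral_add i1 i2, integral_mul_exp_neg hζ, integral_mul_exp_neg (hmr hζ),
      integral_mul_exp_neg (hpr hζ)]
    ring

end Massless

/-! ### From the spectral form to the rates. -/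

section Rates

/-- The correlation as a function of the time separation. -/
def spectralCorrelation (ρ : ℝ → ℝ) (ε s : ℝ) : ℂ :=
  1 / (2 * (Real.pi : ℂ)) *
    ∫ ν : ℝ, (ρ (-ν) : ℂ) * Complex.exp (-((ε + Complex.I * s) * ν))

variable {W : ℝ → Point → Point → ℂ} {γ : ℝ → Point} {ρ : ℝ → ℝ}

theorem HasSpectralRate.correlation_eq_spectralCorrelation (h : HasSpectralRate W γ ρ) {ε : ℝ}
    (hε : 0 < ε) (a b : ℝ) : derivCorrelation (W ε) γ a b = spectralCorrelation ρ ε (a - b) := by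
  rw [h.correlation_eq ε hε, spectralCorrelation, Complex.ofReal_sub]

theorem mul_exp_split (r : ℂ) (ε s ν : ℝ) :
    r * Complex.exp (-((ε + Complex.I * s) * ν)) =
      (r * Complex.exp (-((ε : ℂ) * ν))) * Complex.exp ((-(s * ν) : ℝ) * Complex.I) := by
  rw [mul_assoc, ← Complex.exp_add]
  push_cast
  ring_nf

theorem HasSpectralRate.continuous_spectralCorrelation (h : HasSpectralRate W γ ρ) {ε : ℝ}
    (hε : 0 < ε) : Continuous (spectralCorrelation ρ ε) := by
  refine continuous_const.mul ?_
  simp only [mul_exp_split]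
  refine continuous_of_dominated
    (bound := fun ν => ‖(ρ (-ν) : ℂ) * Complex.exp (-((ε : ℂ) * ν))‖) (fun s => ?_) (fun s => ?_)
    (h.integrable ε hε).norm (ae_of_all _ fun ν => by fun_prop)
  · exact (h.integrable ε hε).aestronglyMeasurable.mul (by fun_prop)
  · exact ae_of_all _ fun ν => by rw [norm_mul, Complex.norm_exp_ofReal_mul_I, mul_one]

theorem exists_lipschitz_at {E ε : ℝ}
    (hρ : (fun x => ρ x - ρ E) =O[𝓝 E] fun x => x - E) :
    ∃ C : ℝ, ∀ᶠ ν in 𝓝 (-E), ‖(ρ (-ν) : ℂ) * Complex.exp (-((ε : ℂ) * ν)) -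
      (ρ (- -E) : ℂ) * Complex.exp (-((ε : ℂ) * (-E : ℝ)))‖ ≤ C * |ν - -E| := by
  have ht : Tendsto (fun ν : ℝ => -ν) (𝓝 (-E)) (𝓝 E) :=
    continuous_neg.tendsto' _ _ (neg_neg E)
  have h1 : (fun ν => ρ (-ν) - ρ E) =O[𝓝 (-E)] fun ν => ν - -E := by
    refine (hρ.comp_tendsto ht).trans (Asymptotics.isBigO_of_le _ fun ν => ?_)
    simp only [Function.comp_apply]
    rw [← norm_neg]
    apply le_of_eq
    congr 1
    ring
  have h2 : (fun ν : ℝ => Real.exp (-(ε * ν))) =O[𝓝 (-E)] (fun _ => (1 : ℝ)) :=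
    (Continuous.tendsto (by fun_prop) (-E)).isBigO_one ℝ
  have h3 : (fun ν : ℝ => Real.exp (-(ε * ν)) - Real.exp (-(ε * -E))) =O[𝓝 (-E)]
      fun ν => ν - -E :=
    DifferentiableAt.isBigO_sub (𝕜 := ℝ) (f := fun ν : ℝ => Real.exp (-(ε * ν))) (by fun_prop)
  have h12 := h1.mul h2
  simp only [mul_one] at h12
  -- The increment of the product is `(ρ(-ν) - ρ(E)) e^{-εν} + ρ(E) (e^{-εν} - e^{εE})`.
  have h4 := h12.add (h3.const_mul_left (ρ E))
  obtain ⟨C, hC⟩ := h4.bound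
  refine ⟨C, hC.mono fun ν hν => ?_⟩
  refine le_trans (le_of_eq ?_) hν
  rw [← Complex.norm_real]
  congr 1
  push_cast
  rw [neg_neg]
  ring

/-- The factor `e^{-iEs}` recentres the phase to `e^{-is(ν + E)}`, so the limit is Fourier inversion
at `ν = -E`; the prefactor `1/2π` cancels the `2π` of inversion. -/
theorem HasSpectralRate.tendsto_integral (h : HasSpectralRate W γ ρ) {E ε : ℝ} (hε : 0 < ε)
    (hρ : (fun x => ρ x - ρ E) =O[𝓝 E] fun x => x - E) :
    Tendsto (fun R : ℝ => ∫ s in (-R)..R,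
      Complex.exp (-Complex.I * (E : ℂ) * (s : ℂ)) * spectralCorrelation ρ ε s)
      atTop (𝓝 (ρ E * Complex.exp (ε * E))) := by
  obtain ⟨C, hC⟩ := exists_lipschitz_at (ε := ε) hρ
  have hpi : (Real.pi : ℂ) ≠ 0 := by exact_mod_cast Real.pi_ne_zero
  have hlim := (tendsto_integral_integral_cexp (h.integrable ε hε) (-E) hC).const_mul
    (1 / (2 * (Real.pi : ℂ)))
  have e : 1 / (2 * (Real.pi : ℂ)) * (2 * Real.pi * ((ρ (- -E) : ℂ) *
      Complex.exp (-((ε : ℂ) * (-E : ℝ))))) = ρ E * Complex.exp (ε * E) := by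
    push_cast
    rw [neg_neg, mul_neg, neg_neg]
    field_simp
  rw [e] at hlim
  refine hlim.congr fun R => ?_
  rw [← intervalIntegral.integral_const_mul (1 / (2 * (Real.pi : ℂ)))]
  congr 1
  funext s
  simp only [spectralCorrelation]
  rw [mul_left_comm, ← integral_const_mul (Complex.exp (-Complex.I * E * s))]
  congr 1
  refine integral_congr_ae (ae_of_all _ fun ν => ?_)
  dsimp only
  rw [mul_left_comm, mul_left_comm (Complex.exp (-Complex.I * E * s)), ← Complex.exp_add,
    ← Complex.exp_add]
  push_cast
  ring_nf

theorem tendsto_mul_exp_mul (r E : ℝ) :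
    Tendsto (fun ε : ℝ => (r : ℂ) * Complex.exp (ε * E)) (𝓝[>] 0) (𝓝 (r : ℂ)) :=
  (Continuous.tendsto' (by fun_prop) 0 _ (by simp)).mono_left nhdsWithin_le_nhds

theorem HasSpectralRate.hasStationaryRate (h : HasSpectralRate W γ ρ) {E : ℝ}
    (hρ : (fun x => ρ x - ρ E) =O[𝓝 E] fun x => x - E) : HasStationaryRate W γ E (ρ E) := by
  refine ⟨fun ε => ρ E * Complex.exp (ε * E), fun ε hε => ?_, tendsto_mul_exp_mul _ _⟩
  simp only [h.correlation_eq_spectralCorrelation hε, sub_zero]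
  exact h.tendsto_integral hε hρ

theorem HasSpectralRate.hasTransitionRate (h : HasSpectralRate W γ ρ) {E : ℝ}
    (hρ : (fun x => ρ x - ρ E) =O[𝓝 E] fun x => x - E) {h₁ h₂ : ℝ → ℝ}
    (hh₁ : IsSwitchProfile h₁) (hh₂ : IsSwitchProfile h₂) (τ : ℝ) :
    HasTransitionRate W γ h₁ h₂ E τ (ρ E) := by
  refine ⟨fun ε => ρ E * Complex.exp (ε * E), fun ε hε => ?_, tendsto_mul_exp_mul _ _⟩
  refine ⟨_, fun τ₀ hτ => hasSharpRate_of_stationary (h.correlation_eq_spectralCorrelation hε)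
    (h.continuous_spectralCorrelation hε) hh₁ hh₂ E hτ, ?_⟩
  have ht : Tendsto (fun τ₀ : ℝ => τ - τ₀) atBot atTop :=
    tendsto_atTop_add_const_left _ τ tendsto_neg_atBot_atTop
  exact (h.tendsto_integral hε hρ).comp ht

theorem differentiableAt_massiveFormula (S : Setting) (d : ℝ) {m E : ℝ} (h : 0 < E ^ 2 - m ^ 2) :
    DifferentiableAt ℝ (fun E => E ^ 2 / √(E ^ 2 - m ^ 2) *
      (1 + S.eta * Real.cos (2 * d * √(E ^ 2 - m ^ 2)))) E := by
  have hs : DifferentiableAt ℝ (fun E : ℝ => √(E ^ 2 - m ^ 2)) E :=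
    DifferentiableAt.sqrt (by fun_prop) h.ne'
  have h0 : √(E ^ 2 - m ^ 2) ≠ 0 := (Real.sqrt_pos.2 h).ne'
  fun_prop (disch := assumption)

theorem massiveRate_isBigO (S : Setting) (d : ℝ) {m E : ℝ} (hm : 0 < m) (hE : E ≠ -m) :
    (fun x => massiveRate S d m x - massiveRate S d m E) =O[𝓝 E] fun x => x - E := by
  refine DifferentiableAt.isBigO_sub (𝕜 := ℝ) (f := massiveRate S d m) ?_
  rcases lt_or_gt_of_ne hE with h | h
  · refine (differentiableAt_massiveFormula S d (m := m) (by nlinarith)).congr_of_eventuallyEq ?_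
    filter_upwards [eventually_lt_nhds h] with x hx
    rw [massiveRate, heaviside, if_pos (by linarith), mul_one]
  · refine (differentiableAt_const (𝕜 := ℝ) (0 : ℝ)).congr_of_eventuallyEq ?_
    filter_upwards [eventually_gt_nhds h] with x hx
    rw [massiveRate, heaviside, if_neg (by linarith), mul_zero]

theorem masslessRate_isBigO (S : Setting) (d E : ℝ) :
    (fun x => masslessRate S d x - masslessRate S d E) =O[𝓝 E] fun x => x - E := by
  rcases lt_trichotomy E 0 with h | rfl | h
  · refine DifferentiableAt.isBigO_sub (𝕜 := ℝ) (f := masslessRate S d) ?_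
    refine DifferentiableAt.congr_of_eventuallyEq
      (f := fun E : ℝ => -E * (1 + S.eta * Real.cos (2 * d * E))) (by fun_prop) ?_
    filter_upwards [eventually_lt_nhds h] with x hx
    rw [masslessRate, heaviside, if_pos (by linarith), mul_one]
  -- At `E = 0` the rate may have a kink, so differentiability is replaced by the direct bound
  -- `|ρ(x)| ≤ 2|x|`.
  · refine Asymptotics.IsBigO.of_bound 2 (Eventually.of_forall fun x => ?_)
    have h1 : |1 + S.eta * Real.cos (2 * d * x)| ≤ 2 := by
      refine (abs_add_le _ _).trans ?_
      rw [abs_one, abs_mul]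
      nlinarith [S.abs_eta_le, Real.abs_cos_le_one (2 * d * x), abs_nonneg S.eta]
    have h2 : |heaviside (-x)| ≤ 1 := by
      rw [heaviside]; split_ifs <;> simp
    have h3 : masslessRate S d 0 = 0 := by simp [masslessRate]
    rw [h3, sub_zero, sub_zero, masslessRate, Real.norm_eq_abs, Real.norm_eq_abs, abs_mul, abs_mul,
      abs_neg]
    calc |x| * |1 + S.eta * Real.cos (2 * d * x)| * |heaviside (-x)|
        ≤ |x| * 2 * 1 := by gcongr
      _ = 2 * |x| := by ring
  · refine DifferentiableAt.isBigO_sub (𝕜 := ℝ) (f := masslessRate S d) ?_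
    refine (differentiableAt_const (𝕜 := ℝ) (0 : ℝ)).congr_of_eventuallyEq ?_
    filter_upwards [eventually_gt_nhds h] with x hx
    rw [masslessRate, heaviside, if_neg (by linarith), mul_zero]

/-! ### Uniqueness of the rates and the massless limit. -/

theorem HasSharpRate.unique {A : ℝ → ℝ → ℂ} {h₁ h₂ : ℝ → ℝ} {E τ₀ τ : ℝ} {r s : ℂ}
    (hr : HasSharpRate A h₁ h₂ E τ₀ τ r) (hs : HasSharpRate A h₁ h₂ E τ₀ τ s) : r = s := by
  obtain ⟨D, hD, hDr⟩ := hr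
  obtain ⟨D', hD', hDs⟩ := hs
  refine tendsto_nhds_unique hDr (hDs.congr' ?_)
  filter_upwards [self_mem_nhdsWithin] with δ hδ using (hD' δ hδ).unique (hD δ hδ)

theorem HasAsymptoticRate.unique {A : ℝ → ℝ → ℂ} {h₁ h₂ : ℝ → ℝ} {E τ : ℝ} {r s : ℂ}
    (hr : HasAsymptoticRate A h₁ h₂ E τ r) (hs : HasAsymptoticRate A h₁ h₂ E τ s) : r = s := by
  obtain ⟨f, hf, hfr⟩ := hr
  obtain ⟨g, hg, hgs⟩ := hs
  refine tendsto_nhds_unique hfr (hgs.congr' ?_)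
  filter_upwards [eventually_lt_atBot τ] with τ₀ hτ using (hg τ₀ hτ).unique (hf τ₀ hτ)

/-- Derivatives and limits are unique at each of the nested stages. This lets the massless limit be
stated for any rates satisfying the definition, not just the explicit formulas. -/
theorem HasTransitionRate.unique {h₁ h₂ : ℝ → ℝ} {E τ r s : ℝ}
    (hr : HasTransitionRate W γ h₁ h₂ E τ r) (hs : HasTransitionRate W γ h₁ h₂ E τ s) :
    r = s := by
  obtain ⟨f, hf, hfr⟩ := hr
  obtain ⟨g, hg, hgs⟩ := hs
  refine Complex.ofReal_injective (tendsto_nhds_unique hfr (hgs.congr' ?_))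
  filter_upwards [self_mem_nhdsWithin] with ε hε using (hg ε hε).unique (hf ε hε)

/-- For `E < 0` the threshold is passed once `m < -E`, and the formula is continuous at `m = 0`,
where `E² / √(E²) = -E`. For `E ≥ 0` both sides vanish. -/
theorem tendsto_massiveRate (S : Setting) (d E : ℝ) :
    Tendsto (fun m => massiveRate S d m E) (𝓝[>] 0) (𝓝 (masslessRate S d E)) := by
  rcases lt_or_ge E 0 with h | h
  · have hs : √(E ^ 2 - 0 ^ 2) = -E := by
      rw [zero_pow two_ne_zero, sub_zero, Real.sqrt_sq_eq_abs, abs_of_neg h]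
    have hc : ContinuousAt (fun m : ℝ => E ^ 2 / √(E ^ 2 - m ^ 2) *
        (1 + S.eta * Real.cos (2 * d * √(E ^ 2 - m ^ 2)))) 0 := by
      have hs0 : √(E ^ 2 - 0 ^ 2) ≠ 0 := by rw [hs]; linarith
      fun_prop (disch := assumption)
    have hv : masslessRate S d E = E ^ 2 / √(E ^ 2 - 0 ^ 2) *
        (1 + S.eta * Real.cos (2 * d * √(E ^ 2 - 0 ^ 2))) := by
      rw [hs, masslessRate, heaviside, if_pos (by linarith), mul_neg, Real.cos_neg, mul_one]
      congr 1
      field_simp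
    rw [hv]
    refine (hc.tendsto.mono_left nhdsWithin_le_nhds).congr' ?_
    filter_upwards [Ioo_mem_nhdsGT (neg_pos.2 h)] with m hm
    rw [massiveRate, heaviside, if_pos (by linarith [hm.2]), mul_one]
  · have hv : masslessRate S d E = 0 := by
      rw [masslessRate, heaviside, if_neg (by linarith), mul_zero]
    rw [hv]
    refine tendsto_const_nhds.congr' ?_
    filter_upwards [self_mem_nhdsWithin] with m (hm : 0 < m)
    rw [massiveRate, heaviside, if_neg (by linarith), mul_zero]

end Rates

end DerivDetector

end

theorem theorem3p1 (S : DerivDetector.Setting) (d : ℝ) (hd : 0 < d) (h₁ h₂ : ℝ → ℝ)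
    (hh₁ : DerivDetector.IsSwitchProfile h₁) (hh₂ : DerivDetector.IsSwitchProfile h₂) (τ : ℝ) :
    -- the massive rate
    (∀ m E : ℝ, 0 < m → E ≠ -m →
      DerivDetector.HasTransitionRate (DerivDetector.massiveWightman S m)
          (DerivDetector.staticWorldline d) h₁ h₂ E τ (DerivDetector.massiveRate S d m E) ∧
        DerivDetector.HasStationaryRate (DerivDetector.massiveWightman S m)
          (DerivDetector.staticWorldline d) E (DerivDetector.massiveRate S d m E)) ∧
    -- the massless rate, for every value of the infrared constant
    (∀ μ E : ℝ, 0 < μ →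
      DerivDetector.HasTransitionRate (DerivDetector.masslessWightman S μ)
          (DerivDetector.staticWorldline d) h₁ h₂ E τ (DerivDetector.masslessRate S d E) ∧
        DerivDetector.HasStationaryRate (DerivDetector.masslessWightman S μ)
          (DerivDetector.staticWorldline d) E (DerivDetector.masslessRate S d E)) ∧
    -- the rates of the massive fields converge to the rate of the massless field
    (∀ (μ E : ℝ) (rate : ℝ → ℝ) (rate₀ : ℝ), 0 < μ →
      (∀ m : ℝ, 0 < m → E ≠ -m →
        DerivDetector.HasTransitionRate (DerivDetector.massiveWightman S m)
          (DerivDetector.staticWorldline d) h₁ h₂ E τ (rate m)) →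
      DerivDetector.HasTransitionRate (DerivDetector.masslessWightman S μ)
          (DerivDetector.staticWorldline d) h₁ h₂ E τ rate₀ →
      Tendsto rate (𝓝[>] 0) (𝓝 rate₀)) := by
  have massive : ∀ m E : ℝ, 0 < m → E ≠ -m →
      DerivDetector.HasTransitionRate (DerivDetector.massiveWightman S m)
          (DerivDetector.staticWorldline d) h₁ h₂ E τ (DerivDetector.massiveRate S d m E) :=
    fun m E hm hE => (DerivDetector.hasSpectralRate_massive S d hm).hasTransitionRate
      (DerivDetector.massiveRate_isBigO S d hm hE) hh₁ hh₂ τ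
  have massless : ∀ μ E : ℝ, 0 < μ →
      DerivDetector.HasTransitionRate (DerivDetector.masslessWightman S μ)
          (DerivDetector.staticWorldline d) h₁ h₂ E τ (DerivDetector.masslessRate S d E) :=
    fun μ E hμ => (DerivDetector.hasSpectralRate_massless S d hμ).hasTransitionRate
      (DerivDetector.masslessRate_isBigO S d E) hh₁ hh₂ τ
  refine ⟨fun m E hm hE => ⟨massive m E hm hE, ?_⟩, fun μ E hμ => ⟨massless μ E hμ, ?_⟩, ?_⟩
  · exact (DerivDetector.hasSpectralRate_massive S d hm).hasStationaryRate
      (DerivDetector.massiveRate_isBigO S d hm hE)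
  · exact (DerivDetector.hasSpectralRate_massless S d hμ).hasStationaryRate
      (DerivDetector.masslessRate_isBigO S d E)
  · intro μ E rate rate₀ hμ hrate hrate₀
    rw [hrate₀.unique (massless μ E hμ)]
    refine (DerivDetector.tendsto_massiveRate S d E).congr' ?_
    -- The one excluded mass, `m = -E`, is avoided for all small `m > 0`.
    have hne : ∀ᶠ m : ℝ in 𝓝[>] 0, E ≠ -m := by
      rcases lt_or_ge E 0 with h | h
      · filter_upwards [Ioo_mem_nhdsGT (neg_pos.2 h)] with m hm
        linarith [hm.2]
      · filter_upwards [self_mem_nhdsWithin] with m (hm : 0 < m)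
        linarith
    filter_upwards [self_mem_nhdsWithin, hne] with m hm hE
    exact (massive m E hm hE).unique (hrate m hm hE)
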